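/- **Conventions.** Let $K$ be a field and $S=K[x_1,\dots,x_N]$ with its $\mathbb{N}^N$-grading. For a monomial ideal $I\subseteq S$, $\beta_{i,\sigma}(S/I)$ denotes the number of summands $S(-\sigma)$ in the $i$-th module of a minimal $\mathbb{N}^N$-graded free resolution of $S/I$, and $\mathcal G(I)$ denotes the minimal set of monomial generators of $I$. Fix an order $m_1,\dots,m_\mu$ of $\mathcal G(I)$. A symbol is a subset $\tau=\{\ell_1<\dots<\ell_s\}$ of $\{1,\dots,\mu\}$; its degree $\deg\tau\in\mathbb{N}^N$ is the exponent vector of $\operatorname{lcm}(m_{\ell_1},\dots,m_{\ell_s})$. The symbol is *$L$-admissible* if for all $1\le t<s$ and all $q<\ell_t$ the monomial $m_q$ does not divide $\operatorname{lcm}(m_{\ell_t},\dots,m_{\ell_s})$. An $L$-admissible symbol is *maximal* if no symbol properly containing it is $L$-admissible. Let $L_s$ be the free $S$-module on the $L$-admissible symbols with $s$ elements ($L_{-1}=0$), and let $d_s$ be the restriction to $L_s$ of the differential of the Taylor complex, $$d_s(\{\ell_1<\dots<\ell_s\})=\sum_{t=1}^{s}(-1)^{t-1}\,\frac{\operatorname{lcm}(m_{\ell_1},\dots,m_{\ell_s})}{\operatorname{lcm}(m_{\ell_1},\dots,\widehat{m_{\ell_t}},\dots,m_{\ell_s})}\;\{\ell_1,\dots,\widehat{\ell_t},\dots,\ell_s\}.$$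 **Proposition.** Let $S^{(k)}=K[x^{(k)}_1,\dots,x^{(k)}_{N_k}]$ $(1\le k\le r)$ be polynomial rings over a field $K$ in disjoint sets of variables. For each $k$ let $I_k\subseteq S^{(k)}$ be a monomial ideal whose minimal monomial generators are listed in a fixed order $m^{(k)}_1,\dots,m^{(k)}_{\mu_k}$, and form $L^{(k)}_s$ and $d^{(k)}_s$ with respect to this order. Assume that for each $k$ there are an $L$-admissible symbol $\tau^{(k)}$ with $s_k$ elements and, for each $L$-admissible symbol $\tau'\neq\tau^{(k)}$ with $s_k$ elements, an element $a^{(k)}_{\tau'}\in S^{(k)}$, such that $$d^{(k)}_{s_k}\Bigl(\tau^{(k)}+\sum_{\tau'\ne\tau^{(k)}}a^{(k)}_{\tau'}\,\tau'\Bigr)\in (x^{(k)}_1,\dots,x^{(k)}_{N_k})\,L^{(k)}_{s_k-1}.$$ Put $\sigma_k=\deg\tau^{(k)}$. Let $S$ be the polynomial ring over $K$ in all the variables $x^{(k)}_j$, let $J\subseteq S$ be a monomial ideal none of whose minimal monomial generators belongs to any $S^{(k)}$, and let $I=I_1S+\dots+I_rS+J$. Suppose that the elements of $\mathcal G(I)$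 are listed, each exactly once, in the order $$m^{(1)}_1,\dots,m^{(1)}_{\mu_1},\ \dots,\ m^{(r)}_1,\dots,m^{(r)}_{\mu_r},\ c_1,\dots,c_\nu,$$ where $c_1,\dots,c_\nu$ are the remaining elements of $\mathcal G(I)$ in an arbitrary order (in particular, all the $m^{(k)}_j$ are assumed to be distinct minimal generators of $I$; if $\mathcal G(J)\subseteq\mathcal G(I)$, then $\{c_1,\dots,c_\nu\}=\mathcal G(J)$). Let $\prod_{k=1}^r\tau^{(k)}$ be the symbol of $I$ whose elements are the positions in this list of the generators $m^{(k)}_j$ with $1\le k\le r$ and $j\in\tau^{(k)}$. If $\prod_{k=1}^r\tau^{(k)}$ is a maximal $L$-admissible symbol for this order, then $$\beta_{s_1+\dots+s_r,\,(\sigma_1,\dots,\sigma_r)}(S/I)\neq 0 .$$ -/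

import Mathlib

open MvPolynomial

noncomputable section

namespace LyubeznikBetti

/-! ### Multigraded free resolutions and multigraded Betti numbers

The polynomial ring `S = K[x_i : i ∈ ι]` is graded by `ι →₀ ℕ`; the exponent vector `a` stands for
the monomial `x ^ a`, divisibility of monomials is the order `≤` of exponent vectors, and the least
common multiple is the supremum. -/

/-- The homogeneous maximal ideal of `S` generated by all the variables. -/
def irrelevant (K ι : Type*) [Field K] : Ideal (MvPolynomial ι K) :=
  Ideal.span (Set.range (X : ι → MvPolynomial ι K))

/-- `v` is homogeneous of degree `σ` in the graded free module `⨁ b, S(-deg b)`: each monomial `x ^ a`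
occurring in the coordinate of `v` at the basis element `b` has `a + deg b = σ`. -/
def IsHomog {K ι B : Type*} [Field K] (deg : B → (ι →₀ ℕ)) (σ : ι →₀ ℕ)
    (v : B →₀ MvPolynomial ι K) : Prop :=
  ∀ b, ∀ a ∈ (v b).support, a + deg b = σ

/-- A minimal multigraded free resolution
`⋯ → ⨁_{b ∈ gen 1} S(-deg b) → ⨁_{b ∈ gen 0} S(-deg b) → M → 0`, by free modules of finite rank, of a
module `M` whose component of degree `σ` is `gr σ`. -/
structure MinimalFreeResolution {K ι : Type*} [Field K] {M : Type*} [AddCommGroup M]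
    [Module (MvPolynomial ι K) M] [Module K M] (gr : (ι →₀ ℕ) → Submodule K M) where
  /-- the basis of the `i`-th free module -/
  gen : ℕ → Type
  finite_gen : ∀ i, Finite (gen i)
  /-- the degrees of the basis elements -/
  deg : ∀ i, gen i → (ι →₀ ℕ)
  /-- the differential from the `(i+1)`-st to the `i`-th free module -/
  d : ∀ i, (gen (i + 1) →₀ MvPolynomial ι K) →ₗ[MvPolynomial ι K] (gen i →₀ MvPolynomial ι K)
  /-- the augmentation -/
  aug : (gen 0 →₀ MvPolynomial ι K) →ₗ[MvPolynomial ι K] M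
  d_homog : ∀ i σ v, IsHomog (deg (i + 1)) σ v → IsHomog (deg i) σ (d i v)
  aug_homog : ∀ σ v, IsHomog (deg 0) σ v → aug v ∈ gr σ
  aug_surjective : Function.Surjective aug
  exact_zero : Function.Exact (d 0) aug
  exact_succ : ∀ i, Function.Exact (d (i + 1)) (d i)
  minimal : ∀ i, LinearMap.range (d i) ≤
    irrelevant K ι • (⊤ : Submodule (MvPolynomial ι K) (gen i →₀ MvPolynomial ι K))

/-- The number of summands `S(-σ)` in the `i`-th module of the resolution. -/
def MinimalFreeResolution.betti {K ι : Type*} [Field K] {M : Type*} [AddCommGroup M]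
    [Module (MvPolynomial ι K) M] [Module K M] {gr : (ι →₀ ℕ) → Submodule K M}
    (F : MinimalFreeResolution gr) (i : ℕ) (σ : ι →₀ ℕ) : ℕ :=
  Nat.card {b : F.gen i // F.deg i b = σ}

/-- The multigraded Betti number `β_{i,σ}(M)`: the number of summands `S(-σ)` in the `i`-th module of a
minimal multigraded free resolution of `M`. All minimal resolutions give the same number, so the
infimum is over a singleton; it would be `0` if there were no minimal resolution. -/
def gradedBetti {K ι : Type*} [Field K] {M : Type*} [AddCommGroup M]
    [Module (MvPolynomial ι K) M] [Module K M] (gr : (ι →₀ ℕ) → Submodule K M)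
    (i : ℕ) (σ : ι →₀ ℕ) : ℕ :=
  sInf {n | ∃ F : MinimalFreeResolution gr, F.betti i σ = n}

/-- The multigrading of `S / I`: the component of degree `σ` is the image of `K x ^ σ`. -/
def quotientGrading {K ι : Type*} [Field K] (I : Ideal (MvPolynomial ι K)) (σ : ι →₀ ℕ) :
    Submodule K (MvPolynomial ι K ⧸ I) :=
  (LinearMap.range (monomial σ : K →ₗ[K] MvPolynomial ι K)).map (Ideal.Quotient.mkₐ K I).toLinearMap

/-! ### Monomial ideals -/

/-- `I` is generated by monomials. -/
def IsMonomialIdeal {K ι : Type*} [Field K] (I : Ideal (MvPolynomial ι K)) : Prop :=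
  ∃ A : Set (ι →₀ ℕ), I = Ideal.span ((fun a => monomial a (1 : K)) '' A)

/-- The exponents of the monomials in `I` that are minimal for divisibility; for a monomial ideal these
are the exponents of the minimal system of monomial generators. -/
def minGens {K ι : Type*} [Field K] (I : Ideal (MvPolynomial ι K)) : Set (ι →₀ ℕ) :=
  {a | Minimal (fun b => monomial b (1 : K) ∈ I) a}

/-- The family `m` lists the minimal monomial generators of `I`, each exactly once, in the order of the
index set. -/
def ListsMinGens {K ι Λ : Type*} [Field K] (I : Ideal (MvPolynomial ι K)) (m : Λ → (ι →₀ ℕ)) : Prop :=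
  Function.Injective m ∧ Set.range m = minGens I

/-! ### The Taylor complex and the Lyubeznik complex

For a list of monomials `m` over a finite linearly ordered index set `Λ`, the symbol
`e_{ℓ₁ ⋯ ℓₛ}`, `ℓ₁ < ⋯ < ℓₛ`, is the finite set `{ℓ₁, …, ℓₛ}`. Its multidegree is `τ.sup m`. -/

/-- `L`-admissibility: for each non-last element `t` of `τ` and each `q < t`, the monomial `m q` does not
divide the least common multiple of the `m u` with `u ∈ τ` and `t ≤ u`. -/
def LAdmissible {ι Λ : Type*} [LinearOrder Λ] (m : Λ → (ι →₀ ℕ)) (τ : Finset Λ) : Prop :=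
  ∀ t ∈ τ, (∃ u ∈ τ, t < u) → ∀ q < t, ¬ m q ≤ (τ.filter (fun u => t ≤ u)).sup m

/-- No symbol properly containing `τ` is `L`-admissible. -/
def NoLargerLAdmissible {ι Λ : Type*} [LinearOrder Λ] (m : Λ → (ι →₀ ℕ)) (τ : Finset Λ) : Prop :=
  ∀ ρ : Finset Λ, τ ⊂ ρ → ¬ LAdmissible m ρ

open scoped Classical in
/-- The `L`-admissible symbols with `s` elements. -/
def admissibleSymbols {ι Λ : Type*} [LinearOrder Λ] [Fintype Λ] (m : Λ → (ι →₀ ℕ)) (s : ℕ) :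
    Finset (Finset Λ) :=
  Finset.univ.filter (fun τ => τ.card = s ∧ LAdmissible m τ)

/-- The differential of the Taylor complex, on the direct sum `Finset Λ →₀ S` of all its terms: the
basis element `τ` goes to the sum over `t ∈ τ`, with sign `(-1) ^ #{u ∈ τ | u < t}`, of
`lcm(τ) / lcm(τ \ {t})` times the basis element `τ \ {t}`. -/
def taylorD (K : Type*) [Field K] {ι Λ : Type*} [LinearOrder Λ] (m : Λ → (ι →₀ ℕ)) :
    (Finset Λ →₀ MvPolynomial ι K) →ₗ[MvPolynomial ι K] (Finset Λ →₀ MvPolynomial ι K) :=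
  Finsupp.linearCombination (MvPolynomial ι K) fun τ =>
    ∑ t ∈ τ, Finsupp.single (τ.erase t)
      (monomial (τ.sup m - (τ.erase t).sup m) ((-1 : K) ^ (τ.filter (fun u => u < t)).card))

/-- The `s`-th term `L_s` of the Lyubeznik complex: the free submodule of the Taylor complex on the
`L`-admissible symbols with `s` elements. -/
def lyubeznik (K : Type*) [Field K] {ι Λ : Type*} [LinearOrder Λ] [Fintype Λ]
    (m : Λ → (ι →₀ ℕ)) (s : ℕ) :
    Submodule (MvPolynomial ι K) (Finset Λ →₀ MvPolynomial ι K) :=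
  Finsupp.supported (MvPolynomial ι K) (MvPolynomial ι K) (admissibleSymbols m s : Set (Finset Λ))

/-! ### Several polynomial rings in disjoint sets of variables -/

/-- The multidegree `(σ_1, …, σ_r)`. -/
def concatDeg {r : ℕ} {N : Fin r → ℕ} (σ : ∀ k, Fin (N k) →₀ ℕ) : (Σ k, Fin (N k)) →₀ ℕ :=
  Finsupp.equivFunOnFinite.symm fun p => σ p.1 p.2

/-- The inclusion of `S^{(k)}` into the polynomial ring `S` in all variables. -/
def incl (K : Type*) [Field K] {r : ℕ} (N : Fin r → ℕ) (k : Fin r) :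
    MvPolynomial (Fin (N k)) K →ₐ[K] MvPolynomial (Σ k, Fin (N k)) K :=
  rename fun j => ⟨k, j⟩

/-- The ideal `I_1 S + ⋯ + I_r S + J` of `S`. -/
def sumIdeal {K : Type*} [Field K] {r : ℕ} {N : Fin r → ℕ}
    (I : ∀ k, Ideal (MvPolynomial (Fin (N k)) K)) (J : Ideal (MvPolynomial (Σ k, Fin (N k)) K)) :
    Ideal (MvPolynomial (Σ k, Fin (N k)) K) :=
  (⨆ k, (I k).map (incl K N k)) ⊔ J

/-- The index set of the list that consists of blocks of sizes `μ 0, …, μ (r-1)`, in this order, followed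
by a last block of size `ν`; the linear order is the lexicographic one. -/
abbrev ConcatIndex {r : ℕ} (μ : Fin r → ℕ) (ν : ℕ) : Type :=
  (Σₗ k : Fin r, Fin (μ k)) ⊕ₗ Fin ν

/-- The list `m_1^{(1)}, …, m_{μ_1}^{(1)}, …, m_1^{(r)}, …, m_{μ_r}^{(r)}, c_1, …, c_ν` of monomials of
`S`. -/
def concatGens {r : ℕ} {N μ : Fin r → ℕ} {ν : ℕ} (m : ∀ k, Fin (μ k) → (Fin (N k) →₀ ℕ))
    (c : Fin ν → ((Σ k, Fin (N k)) →₀ ℕ)) (q : ConcatIndex μ ν) : (Σ k, Fin (N k)) →₀ ℕ :=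
  Sum.elim (fun p : Σₗ k : Fin r, Fin (μ k) =>
    (m (ofLex p).1 (ofLex p).2).mapDomain (Sigma.mk (ofLex p).1)) c (ofLex q)

/-- The product `τ^{(1)} ⋯ τ^{(r)}` of symbols: the `k`-th factor is placed in the `k`-th block, and the
last block is not used. -/
def prodSymbol {r : ℕ} {μ : Fin r → ℕ} (ν : ℕ) (τ : ∀ k, Finset (Fin (μ k))) :
    Finset (ConcatIndex μ ν) :=
  (Finset.univ.sigma τ).map ⟨fun p => toLex (Sum.inl (toLex p)), fun _ _ h =>
    toLex.injective (Sum.inl_injective (toLex.injective h))⟩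

end LyubeznikBetti

end

/-! Write `I` for the sum ideal. The Lyubeznik complex `L` of the concatenated list is a multigraded
free resolution of `S / I`, in general not minimal. A Betti number is therefore the dimension of a
graded piece of the homology of `L ⊗ K`, and it suffices to find, in the right degree, a cycle of `L
⊗ K` that is not a boundary.

The cycle is a product. Reduced modulo the variables and restricted to degree `σ_k`, the hypothesis
on block `k` gives a cycle with coefficient `1` at `τ^{(k)}` (`exists_homogeneous_cycle`). By the
Leibniz rule the product of these cycles is a cycle (`prodCoeff_cycle`). It lives on admissible
symbols, because products of admissible symbols are admissible (`lAdmissible_prodSymbol`), and its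
coefficient at the product symbol is `1`.

It is not a boundary: the differential removes one element from a symbol, so a boundary could meet
the product symbol only through larger admissible symbols, and maximality excludes these.

The homological step avoids Tor (`MinimalFreeResolution.exists_deg_eq_of_cycle`). Comparison maps `φ
: L → F` and `ψ : F → L` with a minimal resolution `F` satisfy `ψ φ - id = d h + h d`. If `F` had no
generator of degree `σ` in the given position, then `φ z` would vanish modulo the variables, and so
would the coefficient of `z` at the maximal symbol.

`gradedBetti` is an infimum over minimal resolutions, so one must exist
(`exists_minimalFreeResolution_quotient`); uniqueness is not needed, since the argument applies to
every `F`. Exactness of `L` is a cone argument in each degree (`exists_taylorD_eq_of_isHomog`). -/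

noncomputable section

namespace LyubeznikBetti

/-! ### Homogeneous elements of graded free modules -/

section Grading

variable {K ι B B' : Type*} [Field K]

open scoped Classical in
/-- The `K`-linear projection of `S(-ρ)` onto its component of degree `σ`. -/
def shiftComp (K : Type*) [Field K] {ι : Type*} (ρ σ : ι →₀ ℕ) :
    MvPolynomial ι K →ₗ[K] MvPolynomial ι K :=
  if ρ ≤ σ then (monomial (σ - ρ)).comp (lcoeff K (σ - ρ)) else 0

open scoped Classical in
lemma coeff_shiftComp (ρ σ a : ι →₀ ℕ) (p : MvPolynomial ι K) :
    coeff a (shiftComp K ρ σ p) = if a + ρ = σ then coeff a p else 0 := by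
  unfold shiftComp
  by_cases h : ρ ≤ σ
  · have : σ - ρ = a ↔ a + ρ = σ := by
      constructor
      · rintro rfl
        exact tsub_add_cancel_of_le h
      · rintro rfl
        simp
    rw [if_pos h]
    simp only [LinearMap.comp_apply, lcoeff_apply, coeff_monomial, this]
    split_ifs with h2
    · rw [this.2 h2]
    · rfl
  · rw [if_neg h, if_neg]
    · simp
    · rintro rfl
      exact h le_add_self

/-- The `K`-linear projection of `⨁ b, S(-deg b)` onto its component of degree `σ`. -/
def homogComp (K : Type*) [Field K] {ι B : Type*} (deg : B → (ι →₀ ℕ)) (σ : ι →₀ ℕ) :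
    (B →₀ MvPolynomial ι K) →ₗ[K] (B →₀ MvPolynomial ι K) :=
  Finsupp.lsum K fun b => (Finsupp.lsingle b).comp (shiftComp K (deg b) σ)

lemma homogComp_apply (deg : B → (ι →₀ ℕ)) (σ : ι →₀ ℕ) (v : B →₀ MvPolynomial ι K) (b : B) :
    homogComp K deg σ v b = shiftComp K (deg b) σ (v b) := by
  classical
  induction v using Finsupp.induction_linear with
  | zero => simp
  | add f g hf hg => simp [hf, hg]
  | single c p =>
    by_cases h : c = b
    · subst h
      simp [homogComp]
    · simp [homogComp, h]

open scoped Classical in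
lemma coeff_homogComp (deg : B → (ι →₀ ℕ)) (σ a : ι →₀ ℕ) (v : B →₀ MvPolynomial ι K) (b : B) :
    coeff a (homogComp K deg σ v b) = if a + deg b = σ then coeff a (v b) else 0 := by
  rw [homogComp_apply, coeff_shiftComp]

lemma ext_coeff {v w : B →₀ MvPolynomial ι K} (h : ∀ b a, coeff a (v b) = coeff a (w b)) :
    v = w :=
  Finsupp.ext fun b => MvPolynomial.ext _ _ fun a => h b a

lemma isHomog_iff {deg : B → (ι →₀ ℕ)} {σ : ι →₀ ℕ} {v : B →₀ MvPolynomial ι K} :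
    IsHomog deg σ v ↔ ∀ b a, coeff a (v b) ≠ 0 → a + deg b = σ := by
  simp [IsHomog, mem_support_iff]

lemma isHomog_homogComp (deg : B → (ι →₀ ℕ)) (σ : ι →₀ ℕ) (v : B →₀ MvPolynomial ι K) :
    IsHomog deg σ (homogComp K deg σ v) := by
  classical
  rw [isHomog_iff]
  intro b a h
  rw [coeff_homogComp] at h
  by_contra h2
  simp [h2] at h

lemma IsHomog.homogComp_eq {deg : B → (ι →₀ ℕ)} {σ : ι →₀ ℕ} {v : B →₀ MvPolynomial ι K}
    (h : IsHomog deg σ v) : homogComp K deg σ v = v := by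
  classical
  refine ext_coeff fun b a => ?_
  rw [coeff_homogComp]
  split_ifs with h2
  · rfl
  · by_contra h3
    exact h2 (isHomog_iff.1 h b a (Ne.symm h3))

lemma IsHomog.homogComp_eq_zero {deg : B → (ι →₀ ℕ)} {σ σ' : ι →₀ ℕ}
    {v : B →₀ MvPolynomial ι K} (h : IsHomog deg σ v) (hne : σ ≠ σ') :
    homogComp K deg σ' v = 0 := by
  classical
  refine ext_coeff fun b a => ?_
  rw [coeff_homogComp]
  split_ifs with h2
  · by_contra h3
    exact hne ((isHomog_iff.1 h b a h3).symm.trans h2)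
  · simp

lemma IsHomog.add {deg : B → (ι →₀ ℕ)} {σ : ι →₀ ℕ} {v w : B →₀ MvPolynomial ι K}
    (hv : IsHomog deg σ v) (hw : IsHomog deg σ w) : IsHomog deg σ (v + w) := by
  rw [isHomog_iff] at *
  intro b a h
  by_cases h1 : coeff a (v b) = 0
  · refine hw b a fun h2 => h ?_
    simp [h1, h2]
  · exact hv b a h1

lemma isHomog_zero (deg : B → (ι →₀ ℕ)) (σ : ι →₀ ℕ) :
    IsHomog deg σ (0 : B →₀ MvPolynomial ι K) := by
  simp [isHomog_iff]

lemma isHomog_sum {α : Type*} {deg : B → (ι →₀ ℕ)} {σ : ι →₀ ℕ} (T : Finset α)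
    (f : α → (B →₀ MvPolynomial ι K)) (h : ∀ x ∈ T, IsHomog deg σ (f x)) :
    IsHomog deg σ (∑ x ∈ T, f x) := by
  classical
  induction T using Finset.induction_on with
  | empty => simpa using isHomog_zero deg σ
  | insert x T hx ih =>
    rw [Finset.sum_insert hx]
    exact (h x (Finset.mem_insert_self _ _)).add
      (ih fun y hy => h y (Finset.mem_insert_of_mem hy))

lemma isHomog_single_monomial (deg : B → (ι →₀ ℕ)) (b : B) (a : ι →₀ ℕ) (c : K) :
    IsHomog deg (a + deg b) (Finsupp.single b (monomial a c)) := by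
  classical
  rw [isHomog_iff]
  intro b' a' h
  by_cases hb : b = b'
  · subst hb
    rw [Finsupp.single_eq_same, coeff_monomial] at h
    by_cases ha : a = a'
    · rw [ha]
    · simp [ha] at h
  · simp [hb] at h

lemma IsHomog.monomial_smul {deg : B → (ι →₀ ℕ)} {σ : ι →₀ ℕ} {v : B →₀ MvPolynomial ι K}
    (hv : IsHomog deg σ v) (a : ι →₀ ℕ) (c : K) : IsHomog deg (a + σ) (monomial a c • v) := by
  classical
  rw [isHomog_iff] at *
  intro b a' h
  rw [Finsupp.smul_apply, smul_eq_mul, coeff_monomial_mul'] at h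
  by_cases h1 : a ≤ a'
  · rw [if_pos h1] at h
    rw [← hv b _ (right_ne_zero_of_mul h), ← add_assoc, add_tsub_cancel_of_le h1]
  · simp [h1] at h

lemma eq_sum_single_monomial (v : B →₀ MvPolynomial ι K) :
    v = ∑ b ∈ v.support, ∑ a ∈ (v b).support,
      Finsupp.single b (monomial a (coeff a (v b))) := by
  conv_lhs => rw [← Finsupp.sum_single v, Finsupp.sum]
  refine Finset.sum_congr rfl fun b _ => ?_
  conv_lhs => rw [(v b).as_sum]
  simp only [Finsupp.single_finsetSum]

lemma isHomog_map {deg : B → (ι →₀ ℕ)} {deg' : B' → (ι →₀ ℕ)}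
    {f : (B →₀ MvPolynomial ι K) →ₗ[MvPolynomial ι K] (B' →₀ MvPolynomial ι K)}
    (hf : ∀ b, IsHomog deg' (deg b) (f (Finsupp.single b 1))) {σ : ι →₀ ℕ}
    {v : B →₀ MvPolynomial ι K} (hv : IsHomog deg σ v) : IsHomog deg' σ (f v) := by
  rw [eq_sum_single_monomial v, map_sum]
  refine isHomog_sum _ _ fun b _ => ?_
  rw [map_sum]
  refine isHomog_sum _ _ fun a ha => ?_
  have : Finsupp.single b (monomial a (coeff a (v b))) =
      monomial a (coeff a (v b)) • Finsupp.single b (1 : MvPolynomial ι K) := by simp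
  rw [this, map_smul, ← hv b a ha]
  exact (hf b).monomial_smul _ _

lemma map_homogComp {deg : B → (ι →₀ ℕ)} {deg' : B' → (ι →₀ ℕ)}
    {f : (B →₀ MvPolynomial ι K) →ₗ[MvPolynomial ι K] (B' →₀ MvPolynomial ι K)}
    (hf : ∀ σ v, IsHomog deg σ v → IsHomog deg' σ (f v)) (σ : ι →₀ ℕ)
    (v : B →₀ MvPolynomial ι K) : f (homogComp K deg σ v) = homogComp K deg' σ (f v) := by
  rw [eq_sum_single_monomial v]
  simp only [map_sum]
  refine Finset.sum_congr rfl fun b _ => Finset.sum_congr rfl fun a _ => ?_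
  have h := isHomog_single_monomial deg b a (coeff a (v b))
  by_cases hσ : a + deg b = σ
  · rw [hσ] at h
    rw [h.homogComp_eq, (hf _ _ h).homogComp_eq]
  · rw [h.homogComp_eq_zero hσ, (hf _ _ h).homogComp_eq_zero hσ, map_zero]

/-- Degrees that do not occur in `v` contribute zero, so the set of summation can be enlarged; `U`
serves to force a chosen degree into it. -/
lemma exists_eq_sum_homogComp (deg : B → (ι →₀ ℕ)) (v : B →₀ MvPolynomial ι K)
    (U : Finset (ι →₀ ℕ)) :
    ∃ T : Finset (ι →₀ ℕ), U ⊆ T ∧ v = ∑ σ ∈ T, homogComp K deg σ v := by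
  classical
  refine ⟨U ∪ v.support.biUnion fun b => (v b).support.image (· + deg b),
    Finset.subset_union_left, ext_coeff fun b a => ?_⟩
  rw [Finsupp.finsetSum_apply, coeff_sum]
  simp only [coeff_homogComp, Finset.sum_ite_eq]
  split_ifs with h
  · rfl
  · by_contra h0
    refine h (Finset.mem_union_right _ (Finset.mem_biUnion.2 ⟨b, ?_, ?_⟩))
    · rw [Finsupp.mem_support_iff]
      intro h1
      simp [h1] at h0
    · exact Finset.mem_image_of_mem _ (mem_support_iff.2 h0)

lemma mem_irrelevant_iff {p : MvPolynomial ι K} :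
    p ∈ irrelevant K ι ↔ constantCoeff p = 0 := by
  have h : irrelevant K ι = Ideal.span (X '' (Set.univ : Set ι)) := by
    rw [Set.image_univ]
    rfl
  rw [h, mem_ideal_span_X_image, constantCoeff_eq]
  constructor
  · intro h0
    by_contra h1
    obtain ⟨i, _, hi⟩ := h0 0 (mem_support_iff.2 h1)
    exact hi rfl
  · intro h0 a ha
    by_contra! h1
    have : a = 0 := Finsupp.ext fun i => h1 i (Set.mem_univ i)
    rw [this, mem_support_iff] at ha
    exact ha h0

/-- Turns reduction modulo the variables, that is, tensoring with `K`, into reading off constant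
coefficients. -/
lemma mem_irrelevant_smul_top_iff {v : B →₀ MvPolynomial ι K} :
    v ∈ irrelevant K ι • (⊤ : Submodule (MvPolynomial ι K) (B →₀ MvPolynomial ι K)) ↔
      ∀ b, constantCoeff (v b) = 0 := by
  constructor
  · intro h b
    refine Submodule.smul_induction_on h (fun p hp w _ => ?_) (fun x y hx hy => ?_)
    · simp [mem_irrelevant_iff.1 hp]
    · simp [hx, hy]
  · intro h
    rw [← Finsupp.sum_single v, Finsupp.sum]
    refine Submodule.sum_mem _ fun b _ => ?_
    rw [← Finsupp.smul_single_one]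
    exact Submodule.smul_mem_smul (mem_irrelevant_iff.2 (h b)) Submodule.mem_top

lemma map_mem_irrelevant_smul_top {M N : Type*} [AddCommGroup M] [AddCommGroup N]
    [Module (MvPolynomial ι K) M] [Module (MvPolynomial ι K) N]
    (f : M →ₗ[MvPolynomial ι K] N) {v : M}
    (hv : v ∈ irrelevant K ι • (⊤ : Submodule (MvPolynomial ι K) M)) :
    f v ∈ irrelevant K ι • (⊤ : Submodule (MvPolynomial ι K) N) := by
  have := Submodule.mem_map_of_mem (f := f) hv
  rw [Submodule.map_smul''] at this
  exact Submodule.smul_mono le_rfl le_top this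

end Grading

/-! ### Existence of minimal multigraded free resolutions -/

/-- Dependent choice along `ℕ`, for a type that varies with the index. -/
lemma exists_dependent_seq {α : ℕ → Type*} (P : ∀ i, α i → Prop)
    (R : ∀ i, α i → α (i + 1) → Prop) (h0 : ∃ a, P 0 a)
    (hs : ∀ i a, P i a → ∃ b, P (i + 1) b ∧ R i a b) :
    ∃ f : ∀ i, α i, ∀ i, P i (f i) ∧ R i (f i) (f (i + 1)) := by
  choose g hg using hs
  obtain ⟨a, ha⟩ := h0
  let f : ∀ i, {x : α i // P i x} := fun i =>
    Nat.rec ⟨a, ha⟩ (fun i x => ⟨g i x.1 x.2, (hg i x.1 x.2).1⟩) i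
  exact ⟨fun i => (f i).1, fun i => ⟨(f i).2, (hg i (f i).1 (f i).2).2⟩⟩

/-! ### Membership in monomial ideals -/

section MonomialIdeal

variable {K ι : Type*} [Field K]

lemma IsMonomialIdeal.monomial_coeff_mem {I : Ideal (MvPolynomial ι K)} (hI : IsMonomialIdeal I)
    {p : MvPolynomial ι K} (hp : p ∈ I) (a : ι →₀ ℕ) : monomial a (coeff a p) ∈ I := by
  classical
  obtain ⟨A, rfl⟩ := hI
  rw [mem_ideal_span_monomial_image] at *
  intro b hb
  have hb' : b = a := by
    rw [mem_support_iff, coeff_monomial] at hb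
    by_contra h
    simp [Ne.symm h] at hb
  subst hb'
  refine hp b ?_
  rw [mem_support_iff] at *
  rwa [coeff_monomial, if_pos rfl] at hb

lemma IsMonomialIdeal.monomial_one_mem {I : Ideal (MvPolynomial ι K)} (hI : IsMonomialIdeal I)
    {p : MvPolynomial ι K} (hp : p ∈ I) {a : ι →₀ ℕ} (ha : coeff a p ≠ 0) :
    monomial a (1 : K) ∈ I := by
  have h := I.mul_mem_left (C (coeff a p)⁻¹) (hI.monomial_coeff_mem hp a)
  rwa [C_mul_monomial, inv_mul_cancel₀ ha] at h

lemma mem_of_forall_monomial_mem {I : Ideal (MvPolynomial ι K)}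
    {p : MvPolynomial ι K} (h : ∀ a, coeff a p ≠ 0 → monomial a (1 : K) ∈ I) : p ∈ I := by
  rw [p.as_sum]
  refine I.sum_mem fun a ha => ?_
  have := I.mul_mem_left (C (coeff a p)) (h a (mem_support_iff.1 ha))
  rwa [C_mul_monomial, mul_one] at this

end MonomialIdeal

/-! ### Graded submodules and their minimal covers -/

section Existence

variable {K ι : Type*} [Field K]

/-- A submodule of a graded free module is graded if it contains the homogeneous components of its
elements. -/
def IsGradedSubmodule {K ι B : Type*} [Field K] (deg : B → (ι →₀ ℕ))
    (P : Submodule (MvPolynomial ι K) (B →₀ MvPolynomial ι K)) : Prop :=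
  ∀ v ∈ P, ∀ σ, homogComp K deg σ v ∈ P

lemma isGradedSubmodule_ker {B B' : Type*} {deg : B → (ι →₀ ℕ)} {deg' : B' → (ι →₀ ℕ)}
    {f : (B →₀ MvPolynomial ι K) →ₗ[MvPolynomial ι K] (B' →₀ MvPolynomial ι K)}
    (hf : ∀ σ v, IsHomog deg σ v → IsHomog deg' σ (f v)) :
    IsGradedSubmodule deg (LinearMap.ker f) := by
  intro v hv σ
  rw [LinearMap.mem_ker] at *
  rw [map_homogComp hf, hv, map_zero]

/-- By the Noetherian property there is a finite generating set; the homogeneous components of its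
elements still lie in `P` and generate it. -/
lemma IsGradedSubmodule.exists_homogeneous_generators [Finite ι] {B : Type*} [Finite B]
    {deg : B → (ι →₀ ℕ)} {P : Submodule (MvPolynomial ι K) (B →₀ MvPolynomial ι K)}
    (hP : IsGradedSubmodule deg P) :
    ∃ (n : ℕ) (g : Fin n → (B →₀ MvPolynomial ι K)) (deg' : Fin n → (ι →₀ ℕ)),
      (∀ j, IsHomog deg (deg' j) (g j)) ∧ Submodule.span (MvPolynomial ι K) (Set.range g) = P := by
  classical
  obtain ⟨U, hU⟩ := IsNoetherian.noetherian P
  choose T _ hT using fun v : B →₀ MvPolynomial ι K => exists_eq_sum_homogComp deg v ∅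
  let G := U.sigma T
  let e := G.equivFin
  refine ⟨G.card, fun j => homogComp K deg (e.symm j).1.2 (e.symm j).1.1,
    fun j => (e.symm j).1.2, fun j => isHomog_homogComp _ _ _, le_antisymm ?_ ?_⟩
  · rw [Submodule.span_le]
    rintro _ ⟨j, rfl⟩
    refine hP _ ?_ _
    rw [← hU]
    exact Submodule.subset_span (Finset.mem_sigma.1 (e.symm j).2).1
  · rw [← hU, Submodule.span_le]
    intro v hv
    rw [SetLike.mem_coe, hT v]
    refine Submodule.sum_mem _ fun σ hσ => Submodule.subset_span ?_
    exact ⟨e ⟨⟨v, σ⟩, Finset.mem_sigma.2 ⟨hv, hσ⟩⟩, by simp⟩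

/-- Graded Nakayama: take a homogeneous generating family of least size. A relation with a nonzero
constant coefficient would express one generator through the others, which could then be dropped. -/
lemma IsGradedSubmodule.exists_minimal_cover [Finite ι] {B : Type*} [Finite B]
    {deg : B → (ι →₀ ℕ)} {P : Submodule (MvPolynomial ι K) (B →₀ MvPolynomial ι K)}
    (hP : IsGradedSubmodule deg P) :
    ∃ (n : ℕ) (deg' : Fin n → (ι →₀ ℕ))
      (f : (Fin n →₀ MvPolynomial ι K) →ₗ[MvPolynomial ι K] (B →₀ MvPolynomial ι K)),
      (∀ σ v, IsHomog deg' σ v → IsHomog deg σ (f v)) ∧ LinearMap.range f = P ∧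
      LinearMap.ker f ≤ irrelevant K ι • ⊤ := by
  classical
  have hex := hP.exists_homogeneous_generators
  obtain ⟨g, deg', hg, hspan⟩ := Nat.find_spec hex
  have hmin : ∀ k < Nat.find hex, _ := fun k hk => Nat.find_min hex hk
  generalize Nat.find hex = n at g deg' hmin
  have hf : ∀ σ v, IsHomog deg' σ v →
      IsHomog deg σ (Finsupp.linearCombination (MvPolynomial ι K) g v) :=
    fun σ v hv => isHomog_map (fun j => by simpa using hg j) hv
  refine ⟨n, deg', Finsupp.linearCombination _ g, hf, ?_, ?_⟩
  · rw [Finsupp.range_linearCombination, hspan]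
  · intro v hv
    rw [mem_irrelevant_smul_top_iff]
    intro j
    by_contra hc
    obtain ⟨n, rfl⟩ : ∃ k, n = k + 1 := ⟨n - 1, by have := j.2; omega⟩
    refine hmin n (Nat.lt_succ_self n)
      ⟨g ∘ j.succAbove, deg' ∘ j.succAbove, fun i => hg _, le_antisymm ?_ ?_⟩
    · rw [← hspan]
      exact Submodule.span_mono (Set.range_comp_subset_range _ _)
    · rw [← hspan, Submodule.span_le]
      -- The component of the relation in degree `deg' j` has only the exponent `0` available at
      -- `j`, so its coefficient there is a nonzero scalar and can be inverted.
      have hw := isGradedSubmodule_ker hf v hv (deg' j)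
      set w := homogComp K deg' (deg' j) v with hwdef
      have hwj : w j = C (constantCoeff (v j)) := by
        refine MvPolynomial.ext _ _ fun a => ?_
        rw [hwdef, coeff_homogComp, coeff_C, constantCoeff_eq]
        by_cases ha : a = 0
        · simp [ha]
        · simp [ha, Ne.symm ha]
      rw [LinearMap.mem_ker, Finsupp.linearCombination_apply, Finsupp.sum_fintype _ _ (by simp),
        Fin.sum_univ_succAbove _ j, hwj] at hw
      rintro _ ⟨i, rfl⟩
      have hj : g j ∈ Submodule.span (MvPolynomial ι K) (Set.range (g ∘ j.succAbove)) := by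
        have h1 : g j = -((C (constantCoeff (v j))⁻¹ : MvPolynomial ι K) •
            ∑ i, w (j.succAbove i) • g (j.succAbove i)) := by
          rw [← neg_eq_of_add_eq_zero_right hw, smul_neg, neg_neg, smul_smul, ← C_mul,
            inv_mul_cancel₀ hc, C_1, one_smul]
        rw [h1]
        refine Submodule.neg_mem _ (Submodule.smul_mem _ _ (Submodule.sum_mem _ fun i _ =>
          Submodule.smul_mem _ _ (Submodule.subset_span ⟨i, rfl⟩)))
      by_cases hij : i = j
      · rw [hij]
        exact hj
      · obtain ⟨k, rfl⟩ := Fin.exists_succAbove_eq hij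
        exact Submodule.subset_span ⟨k, rfl⟩

/-- A finitely generated graded free module with a submodule, to be covered in the next step of a
free resolution. -/
structure ResolutionStage (K ι : Type*) [Field K] where
  /-- the rank -/
  rank : ℕ
  /-- the degrees of the basis elements -/
  deg : Fin rank → (ι →₀ ℕ)
  /-- the module of cycles -/
  cycles : Submodule (MvPolynomial ι K) (Fin rank →₀ MvPolynomial ι K)

lemma exists_minimalFreeResolution [Finite ι] {M : Type*} [AddCommGroup M]
    [Module (MvPolynomial ι K) M] [Module K M] (gr : (ι →₀ ℕ) → Submodule K M)
    {n : ℕ} (deg₀ : Fin n → (ι →₀ ℕ))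
    (aug : (Fin n →₀ MvPolynomial ι K) →ₗ[MvPolynomial ι K] M)
    (haug : ∀ σ v, IsHomog deg₀ σ v → aug v ∈ gr σ) (hsurj : Function.Surjective aug)
    (hgr : IsGradedSubmodule deg₀ (LinearMap.ker aug))
    (hker : LinearMap.ker aug ≤ irrelevant K ι • ⊤) :
    Nonempty (MinimalFreeResolution gr) := by
  -- The last clause pins the initial stage, which the dependent choice does not return; the
  -- augmentation is later transported along this equality.
  let P : ℕ → ResolutionStage K ι → Prop := fun i A =>
    IsGradedSubmodule A.deg A.cycles ∧ A.cycles ≤ irrelevant K ι • ⊤ ∧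
      (i = 0 → A = ⟨n, deg₀, LinearMap.ker aug⟩)
  let R : ℕ → ResolutionStage K ι → ResolutionStage K ι → Prop := fun _ A A' =>
    ∃ f : (Fin A'.rank →₀ MvPolynomial ι K) →ₗ[MvPolynomial ι K]
        (Fin A.rank →₀ MvPolynomial ι K),
      (∀ σ v, IsHomog A'.deg σ v → IsHomog A.deg σ (f v)) ∧ LinearMap.range f = A.cycles ∧
      LinearMap.ker f = A'.cycles
  obtain ⟨F, hF⟩ := exists_dependent_seq P R ⟨⟨n, deg₀, LinearMap.ker aug⟩, hgr, hker, fun _ => rfl⟩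
    (fun i A hA => by
      obtain ⟨n', deg', f, hf, hrange, hk⟩ := hA.1.exists_minimal_cover
      exact ⟨⟨n', deg', LinearMap.ker f⟩, ⟨isGradedSubmodule_ker hf, hk, by simp⟩,
        f, hf, hrange, rfl⟩)
  choose d hd hrange hk using fun i => (hF i).2
  have h0 := (hF 0).1.2.2 rfl
  obtain ⟨aug', haug', hsurj', hker'⟩ :
      ∃ aug' : (Fin (F 0).rank →₀ MvPolynomial ι K) →ₗ[MvPolynomial ι K] M,
        (∀ σ v, IsHomog (F 0).deg σ v → aug' v ∈ gr σ) ∧ Function.Surjective aug' ∧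
        LinearMap.ker aug' = (F 0).cycles := by
    rw [h0]
    exact ⟨aug, haug, hsurj, rfl⟩
  exact ⟨{
    gen := fun i => Fin (F i).rank
    finite_gen := fun i => inferInstance
    deg := fun i => (F i).deg
    d := d
    aug := aug'
    d_homog := fun i σ v hv => hd i σ v hv
    aug_homog := haug'
    aug_surjective := hsurj'
    exact_zero := LinearMap.exact_iff.2 (by rw [hker', hrange])
    exact_succ := fun i => LinearMap.exact_iff.2 (by rw [hk, hrange])
    minimal := fun i => (hrange i).trans_le (hF i).1.2.1 }⟩

lemma exists_minimalFreeResolution_quotient [Finite ι] {I : Ideal (MvPolynomial ι K)}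
    (hI : IsMonomialIdeal I) : Nonempty (MinimalFreeResolution (quotientGrading I)) := by
  classical
  by_cases htop : I = ⊤
  -- The zero module needs rank `0`: the map `S → S / I` has kernel `S`, which is not inside the
  -- irrelevant ideal.
  · have : Subsingleton (MvPolynomial ι K ⧸ I) := Ideal.Quotient.subsingleton_iff.2 htop
    refine exists_minimalFreeResolution (n := 0) _ (fun _ => 0) 0 ?_ ?_ ?_ ?_
    · intro σ v _
      exact Submodule.zero_mem _
    · intro x
      exact ⟨0, Subsingleton.elim _ _⟩
    · intro v _ σ
      exact Subsingleton.elim _ _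
    · intro v _
      rw [Subsingleton.elim v 0]
      exact Submodule.zero_mem _
  · let aug : (Fin 1 →₀ MvPolynomial ι K) →ₗ[MvPolynomial ι K] MvPolynomial ι K ⧸ I :=
      (Submodule.mkQ I).comp (Finsupp.lapply 0)
    have hker : ∀ v, v ∈ LinearMap.ker aug ↔ v 0 ∈ I := fun v => by
      simp [aug, Ideal.Quotient.eq_zero_iff_mem]
    refine exists_minimalFreeResolution (n := 1) _ (fun _ => 0) aug ?_ ?_ ?_ ?_
    · intro σ v hv
      refine ⟨monomial σ (coeff σ (v 0)), ⟨_, rfl⟩, ?_⟩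
      have : monomial σ (coeff σ (v 0)) = v 0 := by
        refine MvPolynomial.ext _ _ fun a => ?_
        rw [coeff_monomial]
        split_ifs with h
        · rw [h]
        · by_contra h0
          exact h (by simpa using (isHomog_iff.1 hv 0 a (Ne.symm h0)).symm)
      rw [this]
      rfl
    · intro x
      obtain ⟨p, rfl⟩ := Ideal.Quotient.mk_surjective x
      exact ⟨Finsupp.single 0 p, by simp [aug]⟩
    · intro v hv σ
      rw [hker] at *
      refine mem_of_forall_monomial_mem fun a ha => ?_
      rw [coeff_homogComp] at ha
      split_ifs at ha with h
      · exact hI.monomial_one_mem hv ha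
      · exact absurd rfl ha
    · intro v hv
      rw [hker] at hv
      rw [mem_irrelevant_smul_top_iff]
      intro b
      rw [Subsingleton.elim b 0]
      by_contra h
      rw [constantCoeff_eq] at h
      exact htop ((Ideal.eq_top_iff_one I).2 (hI.monomial_one_mem hv h))

end Existence

/-! ### The simplicial chain complex of subsets of a linear order -/

section Simplicial

variable {K Λ : Type*} [Field K] [LinearOrder Λ]

/-- The sign of the face of `τ` opposite to `t`; it does not depend on whether `t ∈ τ`. -/
def faceSign (K : Type*) [Field K] {Λ : Type*} [LinearOrder Λ] (τ : Finset Λ) (t : Λ) : K :=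
  (-1) ^ (τ.filter (fun u => u < t)).card

lemma faceSign_insert_of_not_lt {τ : Finset Λ} {t q : Λ} (h : ¬ q < t) :
    faceSign K (insert q τ) t = faceSign K τ t := by
  rw [faceSign, faceSign, Finset.filter_insert, if_neg h]

lemma faceSign_insert_of_lt {τ : Finset Λ} {t q : Λ} (hq : q ∉ τ) (h : q < t) :
    faceSign K (insert q τ) t = -faceSign K τ t := by
  rw [faceSign, faceSign, Finset.filter_insert, if_pos h, Finset.card_insert_of_notMem, pow_succ]
  · ring
  · simp [hq]

lemma faceSign_erase_of_not_lt {τ : Finset Λ} {t q : Λ} (h : ¬ q < t) :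
    faceSign K (τ.erase q) t = faceSign K τ t := by
  by_cases hq : q ∈ τ
  · conv_rhs => rw [← Finset.insert_erase hq, faceSign_insert_of_not_lt h]
  · rw [Finset.erase_eq_of_notMem hq]

lemma faceSign_erase_of_lt {τ : Finset Λ} {t q : Λ} (hq : q ∈ τ) (h : q < t) :
    faceSign K (τ.erase q) t = -faceSign K τ t := by
  conv_rhs => rw [← Finset.insert_erase hq, faceSign_insert_of_lt (Finset.notMem_erase q τ) h,
    neg_neg]

lemma faceSign_eq_one {τ : Finset Λ} {q : Λ} (h : ∀ t ∈ τ, q ≤ t) : faceSign K τ q = 1 := by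
  rw [faceSign, Finset.filter_false_of_mem fun t ht => not_lt.2 (h t ht)]
  simp

/-- The simplicial boundary map, on all finite subsets. -/
def simplicialD (K Λ : Type*) [Field K] [LinearOrder Λ] :
    (Finset Λ →₀ K) →ₗ[K] (Finset Λ →₀ K) :=
  Finsupp.linearCombination K fun τ => ∑ t ∈ τ, Finsupp.single (τ.erase t) (faceSign K τ t)

lemma simplicialD_single (τ : Finset Λ) (c : K) :
    simplicialD K Λ (Finsupp.single τ c) =
      c • ∑ t ∈ τ, Finsupp.single (τ.erase t) (faceSign K τ t) := by
  simp [simplicialD]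

lemma simplicialD_simplicialD (c : Finset Λ →₀ K) : simplicialD K Λ (simplicialD K Λ c) = 0 := by
  induction c using Finsupp.induction_linear with
  | zero => simp
  | add f g hf hg => simp [hf, hg]
  | single τ c =>
    rw [simplicialD_single, map_smul, map_sum]
    refine smul_eq_zero_of_right _ ?_
    simp only [simplicialD_single, Finset.smul_sum]
    rw [Finset.sum_sigma']
    -- Removing `t` then `u` and removing `u` then `t` give the same face with opposite signs.
    refine Finset.sum_involution (fun x _ => ⟨x.2, x.1⟩) ?_ ?_ ?_ ?_
    · rintro ⟨t, u⟩ h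
      simp only [Finset.mem_sigma, Finset.mem_erase] at h
      obtain ⟨ht, hne, hu⟩ := h
      simp only [Finsupp.smul_single, smul_eq_mul]
      rw [Finset.erase_right_comm, ← Finsupp.single_add]
      rcases lt_or_gt_of_ne hne with h | h
      · rw [faceSign_erase_of_not_lt h.not_gt, faceSign_erase_of_lt hu h]
        simp [mul_comm]
      · rw [faceSign_erase_of_not_lt h.not_gt, faceSign_erase_of_lt ht h]
        simp [mul_comm]
    · rintro ⟨t, u⟩ h _ heq
      simp only [Finset.mem_sigma, Finset.mem_erase] at h
      exact h.2.1 (congrArg Sigma.fst heq)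
    · rintro ⟨t, u⟩ h
      simp only [Finset.mem_sigma, Finset.mem_erase] at h ⊢
      exact ⟨h.2.2, Ne.symm h.2.1, h.1⟩
    · intro _ _
      rfl

/-- The cone operator with apex `q`. -/
def coneMap (K : Type*) {Λ : Type*} [Field K] [LinearOrder Λ] (q : Λ) :
    (Finset Λ →₀ K) →ₗ[K] (Finset Λ →₀ K) :=
  Finsupp.linearCombination K fun τ => if q ∈ τ then 0 else Finsupp.single (insert q τ) 1

lemma coneMap_single (q : Λ) (τ : Finset Λ) (c : K) :
    coneMap K q (Finsupp.single τ c) = if q ∈ τ then 0 else Finsupp.single (insert q τ) c := by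
  simp only [coneMap, Finsupp.linearCombination_single]
  split_ifs <;> simp

/-- Since `q` is at most every element of `τ`, the face opposite `q` has sign `+1`. If `q ∈ τ`, only
that face survives the cone; otherwise the faces containing `q` cancel in pairs. -/
lemma simplicialD_coneMap_single {q : Λ} {τ : Finset Λ} (h : ∀ t ∈ τ, q ≤ t) (c : K) :
    simplicialD K Λ (coneMap K q (Finsupp.single τ c)) +
      coneMap K q (simplicialD K Λ (Finsupp.single τ c)) = Finsupp.single τ c := by
  rw [coneMap_single, simplicialD_single, map_smul, map_sum]
  simp only [coneMap_single]
  by_cases hq : q ∈ τ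
  · rw [if_pos hq, map_zero, zero_add, Finset.sum_eq_single_of_mem q hq]
    · rw [if_neg (Finset.notMem_erase q τ), Finset.insert_erase hq, faceSign_eq_one h,
        Finsupp.smul_single_one]
    · intro t _ ht
      rw [if_pos (Finset.mem_erase.2 ⟨Ne.symm ht, hq⟩)]
  · rw [if_neg hq, simplicialD_single, Finset.sum_insert hq, Finset.erase_insert hq,
      faceSign_insert_of_not_lt (lt_irrefl q), faceSign_eq_one h, smul_add,
      Finsupp.smul_single_one, add_assoc, ← smul_add, ← Finset.sum_add_distrib,
      Finset.sum_eq_zero, smul_zero, add_zero]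
    intro t ht
    have hqt : q < t := lt_of_le_of_ne (h t ht) (by rintro rfl; exact hq ht)
    rw [if_neg (fun hm => hq (Finset.mem_of_mem_erase hm)), faceSign_insert_of_lt hq hqt,
      Finset.erase_insert_of_ne hqt.ne]
    simp

lemma simplicialD_coneMap {q : Λ} {c : Finset Λ →₀ K} (h : ∀ τ ∈ c.support, ∀ t ∈ τ, q ≤ t) :
    simplicialD K Λ (coneMap K q c) + coneMap K q (simplicialD K Λ c) = c := by
  conv_lhs => rw [← Finsupp.sum_single c, Finsupp.sum]
  conv_rhs => rw [← Finsupp.sum_single c, Finsupp.sum]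
  simp only [map_sum]
  rw [← Finset.sum_add_distrib]
  exact Finset.sum_congr rfl fun τ hτ => simplicialD_coneMap_single (h τ hτ) _

end Simplicial

/-! ### Exactness of the Lyubeznik complex -/

section Realize

variable {K ι Λ : Type*} [Field K]

/-- The chain `∑ c_τ τ`, homogenized in degree `ρ`. -/
def realize (m : Λ → (ι →₀ ℕ)) (ρ : ι →₀ ℕ) :
    (Finset Λ →₀ K) →ₗ[K] (Finset Λ →₀ MvPolynomial ι K) :=
  Finsupp.lsum K fun τ => (Finsupp.lsingle τ).comp (monomial (ρ - τ.sup m))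

lemma realize_single (m : Λ → (ι →₀ ℕ)) (ρ : ι →₀ ℕ) (τ : Finset Λ) (c : K) :
    realize m ρ (Finsupp.single τ c) = Finsupp.single τ (monomial (ρ - τ.sup m) c) := by
  simp [realize]

lemma realize_apply (m : Λ → (ι →₀ ℕ)) (ρ : ι →₀ ℕ) (c : Finset Λ →₀ K) (τ : Finset Λ) :
    realize m ρ c τ = monomial (ρ - τ.sup m) (c τ) := by
  induction c using Finsupp.induction_linear with
  | zero => simp
  | add f g hf hg => simp [hf, hg]
  | single τ' c =>
    rw [realize_single]
    by_cases h : τ' = τ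
    · subst h
      simp
    · simp [h]

lemma realize_injective (m : Λ → (ι →₀ ℕ)) (ρ : ι →₀ ℕ) :
    Function.Injective (realize m ρ : (Finset Λ →₀ K) →ₗ[K] _) := by
  intro c c' h
  ext τ
  have := DFunLike.congr_fun h τ
  rw [realize_apply, realize_apply] at this
  classical
  simpa [coeff_monomial] using congrArg (coeff (ρ - τ.sup m)) this

/-- In degree `ρ` the coordinate at `τ` can only be a scalar times one monomial, so the element
amounts to a scalar chain. The bound `τ.sup m ≤ ρ` is recorded because the subtraction in `realize`
is truncated. -/
lemma exists_realize_eq [Finite Λ] {m : Λ → (ι →₀ ℕ)} {ρ : ι →₀ ℕ}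
    {v : Finset Λ →₀ MvPolynomial ι K} (hv : IsHomog (fun τ => τ.sup m) ρ v) :
    ∃ c : Finset Λ →₀ K, realize m ρ c = v ∧ (∀ τ ∈ c.support, τ.sup m ≤ ρ) ∧
      ∀ τ ∈ c.support, τ ∈ v.support := by
  classical
  have key : ∀ τ, coeff (ρ - τ.sup m) (v τ) ≠ 0 → τ.sup m ≤ ρ := fun τ h => by
    have := isHomog_iff.1 hv τ _ h
    rw [← this]
    exact le_add_self
  refine ⟨Finsupp.equivFunOnFinite.symm fun τ => coeff (ρ - τ.sup m) (v τ), ?_, ?_, ?_⟩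
  · refine ext_coeff fun τ a => ?_
    rw [realize_apply, coeff_monomial, Finsupp.equivFunOnFinite_symm_apply_apply]
    split_ifs with h
    · rw [h]
    · by_contra h0
      refine h ?_
      rw [← isHomog_iff.1 hv τ a (Ne.symm h0), add_tsub_cancel_right]
  · intro τ hτ
    rw [Finsupp.mem_support_iff] at hτ
    exact key τ hτ
  · intro τ hτ
    rw [Finsupp.mem_support_iff] at *
    intro h0
    simp [h0] at hτ

end Realize

/-! ### The Taylor differential and the Lyubeznik subcomplex -/

section Lyubeznik

variable {K ι Λ : Type*} [Field K] [LinearOrder Λ]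

lemma taylorD_single (m : Λ → (ι →₀ ℕ)) (τ : Finset Λ) (p : MvPolynomial ι K) :
    taylorD K m (Finsupp.single τ p) = ∑ t ∈ τ, Finsupp.single (τ.erase t)
      (p * monomial (τ.sup m - (τ.erase t).sup m) (faceSign K τ t)) := by
  simp [taylorD, faceSign, Finset.smul_sum]

lemma isHomog_taylorD (m : Λ → (ι →₀ ℕ)) {σ : ι →₀ ℕ} {v : Finset Λ →₀ MvPolynomial ι K}
    (hv : IsHomog (fun τ => τ.sup m) σ v) : IsHomog (fun τ => τ.sup m) σ (taylorD K m v) := by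
  refine isHomog_map (fun τ => ?_) hv
  rw [taylorD_single]
  refine isHomog_sum _ _ fun t _ => ?_
  rw [one_mul]
  have h := isHomog_single_monomial (fun τ : Finset Λ => τ.sup m) (τ.erase t)
    (τ.sup m - (τ.erase t).sup m) (faceSign K τ t)
  rwa [tsub_add_cancel_of_le (Finset.sup_mono (Finset.erase_subset t τ))] at h

/-- In a fixed degree the quotients of least common multiples telescope, and the Taylor differential
becomes the simplicial boundary. -/
lemma taylorD_realize {m : Λ → (ι →₀ ℕ)} {ρ : ι →₀ ℕ} {c : Finset Λ →₀ K}
    (hc : ∀ τ ∈ c.support, τ.sup m ≤ ρ) :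
    taylorD K m (realize m ρ c) = realize m ρ (simplicialD K Λ c) := by
  conv_lhs => rw [← Finsupp.sum_single c, Finsupp.sum]
  conv_rhs => rw [← Finsupp.sum_single c, Finsupp.sum]
  simp only [map_sum]
  refine Finset.sum_congr rfl fun τ hτ => ?_
  rw [realize_single, taylorD_single, simplicialD_single, map_smul, map_sum, Finset.smul_sum]
  refine Finset.sum_congr rfl fun t _ => ?_
  rw [realize_single, monomial_mul, Finsupp.smul_single, smul_monomial, smul_eq_mul,
    tsub_add_tsub_cancel (hc τ hτ) (Finset.sup_mono (Finset.erase_subset t τ))]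

lemma taylorD_taylorD [Finite Λ] (m : Λ → (ι →₀ ℕ)) (v : Finset Λ →₀ MvPolynomial ι K) :
    taylorD K m (taylorD K m v) = 0 := by
  classical
  obtain ⟨T, -, hT⟩ := exists_eq_sum_homogComp (fun τ : Finset Λ => τ.sup m) v ∅
  rw [hT, map_sum, map_sum]
  refine Finset.sum_eq_zero fun ρ _ => ?_
  obtain ⟨c, hc, hc1, -⟩ := exists_realize_eq (isHomog_homogComp (fun τ => τ.sup m) ρ v)
  rw [← hc, taylorD_realize hc1]
  have h := isHomog_taylorD m (isHomog_homogComp (fun τ => τ.sup m) ρ v)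
  rw [← hc, taylorD_realize hc1] at h
  rw [taylorD_realize, simplicialD_simplicialD, map_zero]
  intro τ hτ
  rw [Finsupp.mem_support_iff] at hτ
  have := isHomog_iff.1 h τ (ρ - τ.sup m) (by rwa [realize_apply, coeff_monomial, if_pos rfl])
  rw [← this]
  exact le_add_self

lemma LAdmissible.mono {m : Λ → (ι →₀ ℕ)} {τ τ' : Finset Λ} (h : LAdmissible m τ)
    (hsub : τ' ⊆ τ) : LAdmissible m τ' := by
  rintro t ht ⟨u, hu, htu⟩ q hq hle
  exact h t (hsub ht) ⟨u, hsub hu, htu⟩ q hq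
    (hle.trans (Finset.sup_mono (Finset.filter_subset_filter _ hsub)))

/-- Here `q` is the first generator dividing `x ^ ρ`. No earlier one divides a least common multiple
bounded by `ρ`, which settles the condition at `q`. The other elements lie above `q`, so their tails
are unchanged. -/
lemma LAdmissible.insert_of_sup_le {m : Λ → (ι →₀ ℕ)} {τ : Finset Λ} (h : LAdmissible m τ)
    {ρ : ι →₀ ℕ} (hτ : τ.sup m ≤ ρ) {q : Λ} (hq : m q ≤ ρ) (hmin : ∀ q' < q, ¬ m q' ≤ ρ) :
    LAdmissible m (insert q τ) := by
  have hge : ∀ t ∈ τ, q ≤ t := fun t ht => by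
    by_contra hlt
    exact hmin t (not_le.1 hlt) ((Finset.le_sup ht).trans hτ)
  rintro t ht ⟨u, hu, htu⟩ q' hq' hle
  by_cases hqt : t = q
  · subst hqt
    refine hmin q' hq' (hle.trans (Finset.sup_le fun x hx => ?_))
    rcases Finset.mem_insert.1 (Finset.mem_of_mem_filter x hx) with rfl | hx
    · exact hq
    · exact (Finset.le_sup hx).trans hτ
  · have htτ : t ∈ τ := Finset.mem_of_mem_insert_of_ne ht hqt
    have hlt : q < t := lt_of_le_of_ne (hge t htτ) (Ne.symm hqt)
    have huτ : u ∈ τ := Finset.mem_of_mem_insert_of_ne hu (hlt.trans htu).ne'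
    refine h t htτ ⟨u, huτ, htu⟩ q' hq' ?_
    rwa [Finset.filter_insert, if_neg (not_le.2 hlt)] at hle

variable [Fintype Λ]

lemma mem_admissibleSymbols {m : Λ → (ι →₀ ℕ)} {s : ℕ} {τ : Finset Λ} :
    τ ∈ admissibleSymbols m s ↔ τ.card = s ∧ LAdmissible m τ := by
  simp [admissibleSymbols]

lemma mem_lyubeznik {m : Λ → (ι →₀ ℕ)} {s : ℕ} {v : Finset Λ →₀ MvPolynomial ι K} :
    v ∈ lyubeznik K m s ↔ ∀ τ, v τ ≠ 0 → τ ∈ admissibleSymbols m s := by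
  rw [lyubeznik, Finsupp.mem_supported]
  constructor
  · intro h τ hτ
    exact h (by simpa using hτ)
  · intro h τ hτ
    exact h τ (by simpa using hτ)

lemma single_mem_lyubeznik {m : Λ → (ι →₀ ℕ)} {s : ℕ} {τ : Finset Λ}
    (hτ : τ ∈ admissibleSymbols m s) (p : MvPolynomial ι K) :
    Finsupp.single τ p ∈ lyubeznik K m s :=
  Finsupp.single_mem_supported _ _ hτ

lemma taylorD_mem_lyubeznik {m : Λ → (ι →₀ ℕ)} {s : ℕ} {v : Finset Λ →₀ MvPolynomial ι K}
    (hv : v ∈ lyubeznik K m (s + 1)) : taylorD K m v ∈ lyubeznik K m s := by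
  rw [← Finsupp.sum_single v, Finsupp.sum, map_sum]
  refine Submodule.sum_mem _ fun τ hτ => ?_
  have h := mem_admissibleSymbols.1 (mem_lyubeznik.1 hv τ (Finsupp.mem_support_iff.1 hτ))
  rw [taylorD_single]
  refine Submodule.sum_mem _ fun t ht => single_mem_lyubeznik ?_ _
  rw [mem_admissibleSymbols, Finset.card_erase_of_mem ht, h.1]
  exact ⟨rfl, h.2.mono (Finset.erase_subset t τ)⟩

/-- The admissible symbols of degree at most `ρ` form a cone whose apex is the first generator
dividing `x ^ ρ`, and coning off a cycle bounds it. -/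
lemma exists_taylorD_eq_of_isHomog {m : Λ → (ι →₀ ℕ)} {s : ℕ} {ρ : ι →₀ ℕ}
    {v : Finset Λ →₀ MvPolynomial ι K} (hv : v ∈ lyubeznik K m (s + 1))
    (hhom : IsHomog (fun τ => τ.sup m) ρ v) (hd : taylorD K m v = 0) :
    ∃ w ∈ lyubeznik K m (s + 2), taylorD K m w = v := by
  by_cases hex : ∃ j, m j ≤ ρ
  · obtain ⟨c, hc, hc1, hc2⟩ := exists_realize_eq hhom
    have hadm : ∀ τ ∈ c.support, τ.card = s + 1 ∧ LAdmissible m τ := fun τ hτ =>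
      mem_admissibleSymbols.1 (mem_lyubeznik.1 hv τ (Finsupp.mem_support_iff.1 (hc2 τ hτ)))
    obtain ⟨q, hq, hmin⟩ := WellFounded.has_min (wellFounded_lt (α := Λ)) {j | m j ≤ ρ} hex
    have hmin' : ∀ q' < q, ¬ m q' ≤ ρ := fun q' hq' hle => hmin q' hle hq'
    have hge : ∀ τ ∈ c.support, ∀ t ∈ τ, q ≤ t := fun τ hτ t ht => by
      by_contra hlt
      exact hmin' t (not_le.1 hlt) ((Finset.le_sup ht).trans (hc1 τ hτ))
    have hdc : simplicialD K Λ c = 0 := by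
      apply realize_injective m ρ
      rw [← taylorD_realize hc1, hc, hd, map_zero]
    have hcone := simplicialD_coneMap hge
    rw [hdc, map_zero, add_zero] at hcone
    have hsupp : ∀ τ ∈ (coneMap K q c).support,
        τ ∈ admissibleSymbols m (s + 2) ∧ τ.sup m ≤ ρ := by
      intro τ hτ
      rw [coneMap, Finsupp.linearCombination_apply] at hτ
      obtain ⟨τ', hτ', h⟩ := Finset.mem_biUnion.1 (Finsupp.support_sum hτ)
      split_ifs at h with hmem
      · simp at h
      · rw [Finsupp.smul_single_one] at h
        have := Finsupp.support_single_subset h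
        rw [Finset.mem_singleton] at this
        subst this
        rw [mem_admissibleSymbols, Finset.card_insert_of_notMem hmem, (hadm τ' hτ').1]
        refine ⟨⟨rfl, (hadm τ' hτ').2.insert_of_sup_le (hc1 τ' hτ') hq hmin'⟩, ?_⟩
        rw [Finset.sup_insert]
        exact sup_le hq (hc1 τ' hτ')
    refine ⟨realize m ρ (coneMap K q c), ?_, ?_⟩
    · rw [mem_lyubeznik]
      intro τ hτ
      refine (hsupp τ ?_).1
      rw [Finsupp.mem_support_iff]
      intro h0
      rw [realize_apply, h0, map_zero] at hτ
      exact hτ rfl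
    · rw [taylorD_realize fun τ hτ => (hsupp τ hτ).2, hcone, hc]
  -- No generator divides `x ^ ρ`; as symbols with `s + 1` elements are nonempty, `v = 0`.
  · refine ⟨0, Submodule.zero_mem _, ?_⟩
    rw [map_zero]
    refine (ext_coeff fun τ a => ?_).symm
    by_contra h0
    have h1 : v τ ≠ 0 := fun h => h0 (by simp [h])
    have h2 := (mem_admissibleSymbols.1 (mem_lyubeznik.1 hv τ h1)).1
    obtain ⟨t, ht⟩ := Finset.card_pos.1 (h2.symm ▸ Nat.succ_pos s : 0 < τ.card)
    refine hex ⟨t, (Finset.le_sup ht).trans ?_⟩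
    rw [← isHomog_iff.1 hhom τ a h0]
    exact le_add_self

lemma exists_taylorD_eq {m : Λ → (ι →₀ ℕ)} {s : ℕ} {v : Finset Λ →₀ MvPolynomial ι K}
    (hv : v ∈ lyubeznik K m (s + 1)) (hd : taylorD K m v = 0) :
    ∃ w ∈ lyubeznik K m (s + 2), taylorD K m w = v := by
  have hcomp : ∀ ρ, ∃ w ∈ lyubeznik K m (s + 2),
      taylorD K m w = homogComp K (fun τ => τ.sup m) ρ v := fun ρ => by
    refine exists_taylorD_eq_of_isHomog (mem_lyubeznik.2 fun τ hτ => ?_)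
      (isHomog_homogComp _ _ _) ?_
    · refine mem_lyubeznik.1 hv τ fun h0 => hτ ?_
      rw [homogComp_apply, h0, map_zero]
    · rw [map_homogComp (fun σ v => isHomog_taylorD m), hd, map_zero]
  choose w hw hdw using hcomp
  obtain ⟨T, -, hT⟩ := exists_eq_sum_homogComp (fun τ : Finset Λ => τ.sup m) v ∅
  refine ⟨∑ ρ ∈ T, w ρ, Submodule.sum_mem _ fun ρ _ => hw ρ, ?_⟩
  rw [map_sum, hT]
  simp only [hdw]

end Lyubeznik

/-! ### Comparison of free resolutions -/

section Comparison

lemma exists_lift_of_range_le {R P X Y : Type*} [Ring R] [AddCommGroup P] [AddCommGroup X]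
    [AddCommGroup Y] [Module R P] [Module R X] [Module R Y] [Module.Projective R P]
    (f : X →ₗ[R] Y) (g : P →ₗ[R] Y) (h : ∀ p, g p ∈ LinearMap.range f) :
    ∃ k : P →ₗ[R] X, f.comp k = g := by
  obtain ⟨k, hk⟩ := Module.projective_lifting_property f.rangeRestrict
    (g.codRestrict (LinearMap.range f) h) f.surjective_rangeRestrict
  refine ⟨k, LinearMap.ext fun p => ?_⟩
  exact congrArg Subtype.val (LinearMap.congr_fun hk p)

variable {R : Type*} [Ring R] {P Q : ℕ → Type*} [∀ i, AddCommGroup (P i)] [∀ i, Module R (P i)]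
  [∀ i, AddCommGroup (Q i)] [∀ i, Module R (Q i)] {M : Type*} [AddCommGroup M] [Module R M]

lemma exists_chainMap [∀ i, Module.Projective R (P i)] (dP : ∀ i, P (i + 1) →ₗ[R] P i)
    (dQ : ∀ i, Q (i + 1) →ₗ[R] Q i) (augP : P 0 →ₗ[R] M) (augQ : Q 0 →ₗ[R] M)
    (hP0 : Function.Exact (dP 0) augP) (hP : ∀ i, Function.Exact (dP (i + 1)) (dP i))
    (hsurj : Function.Surjective augQ)
    (hQ0 : Function.Exact (dQ 0) augQ) (hQ : ∀ i, Function.Exact (dQ (i + 1)) (dQ i)) :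
    ∃ ψ : ∀ i, P i →ₗ[R] Q i, augQ.comp (ψ 0) = augP ∧
      ∀ i, (dQ i).comp (ψ (i + 1)) = (ψ i).comp (dP i) := by
  -- In positive degrees it is enough to remember that cycles go to cycles: this is what the next
  -- lift uses.
  let A : ∀ i, (P i →ₗ[R] Q i) → Prop := fun i =>
    match i with
    | 0 => fun f => augQ.comp f = augP
    | i + 1 => fun f => ∀ x, dP i x = 0 → dQ i (f x) = 0
  obtain ⟨ψ, hψ⟩ := exists_dependent_seq (α := fun i => P i →ₗ[R] Q i) A
    (fun i f g => (dQ i).comp g = f.comp (dP i))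
    (exists_lift_of_range_le augQ augP fun p => hsurj _) (fun i f hf => by
      have hr : ∀ p, f.comp (dP i) p ∈ LinearMap.range (dQ i) := fun p => by
        cases i with
        | zero =>
          refine (hQ0 _).1 ?_
          have := LinearMap.congr_fun hf (dP 0 p)
          exact this.trans ((hP0 _).2 ⟨p, rfl⟩)
        | succ i => exact (hQ i _).1 (hf _ ((hP i _).2 ⟨p, rfl⟩))
      obtain ⟨k, hk⟩ := exists_lift_of_range_le (dQ i) (f.comp (dP i)) hr
      refine ⟨k, fun x hx => ?_, hk⟩
      have := LinearMap.congr_fun hk x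
      simpa [hx] using this)
  exact ⟨ψ, (hψ 0).1, fun i => (hψ i).2⟩

lemma exists_homotopy [∀ i, Module.Projective R (P i)] (d : ∀ i, P (i + 1) →ₗ[R] P i)
    (aug : P 0 →ₗ[R] M) (h0 : Function.Exact (d 0) aug)
    (hd : ∀ i, Function.Exact (d (i + 1)) (d i)) (g : ∀ i, P i →ₗ[R] P i)
    (hg0 : aug.comp (g 0) = 0) (hg : ∀ i, (d i).comp (g (i + 1)) = (g i).comp (d i)) :
    ∃ h : ∀ i, P i →ₗ[R] P (i + 1), (d 0).comp (h 0) = g 0 ∧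
      ∀ i, (d (i + 1)).comp (h (i + 1)) = g (i + 1) - (h i).comp (d i) := by
  have hdd : ∀ i x, d i (d (i + 1) x) = 0 := fun i x => (hd i _).2 ⟨x, rfl⟩
  obtain ⟨h, hh⟩ := exists_dependent_seq (α := fun i => P i →ₗ[R] P (i + 1))
    -- This identity on boundaries makes `g (i + 1) - k ∘ d i` land in the cycles, hence lift
    -- through `d (i + 1)`.
    (fun i k => (∀ x, d i (k (d i x)) = g i (d i x)) ∧
      ∀ e : i = 0, (d i).comp k = g i)
    (fun i k k' => (d (i + 1)).comp k' = g (i + 1) - k.comp (d i))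
    (by
      obtain ⟨k, hk⟩ := exists_lift_of_range_le (d 0) (g 0)
        fun p => (h0 _).1 (LinearMap.congr_fun hg0 p)
      exact ⟨k, fun x => LinearMap.congr_fun hk _, fun _ => hk⟩)
    (fun i k hk => by
      obtain ⟨k', hk'⟩ := exists_lift_of_range_le (d (i + 1)) (g (i + 1) - k.comp (d i))
        fun p => (hd i _).1 (by
          have := LinearMap.congr_fun (hg i) p
          simp only [LinearMap.comp_apply] at this
          simp [this, hk.1])
      refine ⟨k', ⟨fun x => ?_, fun e => absurd e (Nat.succ_ne_zero i)⟩, hk'⟩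
      have := LinearMap.congr_fun hk' (d (i + 1) x)
      simpa [hdd] using this)
  exact ⟨h, (hh 0).1.2 rfl, fun i => (hh i).2⟩

end Comparison

/-! ### Detecting generators of a minimal resolution from another resolution -/

section Betti

variable {K ι : Type*} [Field K]

lemma MinimalFreeResolution.exists_homogeneous_aug_eq {I : Ideal (MvPolynomial ι K)}
    (hI : IsMonomialIdeal I) (F : MinimalFreeResolution (quotientGrading I)) {σ : ι →₀ ℕ}
    {x : MvPolynomial ι K ⧸ I} (hx : x ∈ quotientGrading I σ) :
    ∃ w, IsHomog (F.deg 0) σ w ∧ F.aug w = x := by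
  classical
  have hgr : ∀ {ρ : ι →₀ ℕ} {y : MvPolynomial ι K ⧸ I}, y ∈ quotientGrading I ρ →
      ∃ c : K, Ideal.Quotient.mk I (monomial ρ c) = y := by
    rintro ρ _ ⟨_, ⟨c, rfl⟩, rfl⟩
    exact ⟨c, rfl⟩
  obtain ⟨c, rfl⟩ := hgr hx
  obtain ⟨w, hw⟩ := F.aug_surjective (Ideal.Quotient.mk I (monomial σ c))
  choose e he using fun ρ => hgr (F.aug_homog ρ _ (isHomog_homogComp (F.deg 0) ρ w))
  refine ⟨homogComp K (F.deg 0) σ w, isHomog_homogComp _ _ _, ?_⟩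
  obtain ⟨T, hσT, hT⟩ := exists_eq_sum_homogComp (F.deg 0) w {σ}
  rw [hT, map_sum, ← Finset.sum_congr rfl fun ρ _ => he ρ, ← map_sum, Ideal.Quotient.eq] at hw
  rw [← he, Ideal.Quotient.eq]
  -- The graded pieces of `S / I` are independent because `I` is monomial: the term of degree `σ` of
  -- an element of `I` is again in `I`.
  have h := hI.monomial_coeff_mem hw σ
  have hmem : σ ∈ T := hσT (Finset.mem_singleton_self σ)
  simpa [coeff_sub, coeff_sum, coeff_monomial, hmem] using h

lemma exists_homogeneous_preimage {B B' : Type*} {deg : B → (ι →₀ ℕ)} {deg' : B' → (ι →₀ ℕ)}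
    {f : (B →₀ MvPolynomial ι K) →ₗ[MvPolynomial ι K] (B' →₀ MvPolynomial ι K)}
    (hf : ∀ σ v, IsHomog deg σ v → IsHomog deg' σ (f v)) {σ : ι →₀ ℕ}
    {y : B' →₀ MvPolynomial ι K} (hy : IsHomog deg' σ y) (hr : y ∈ Set.range f) :
    ∃ w, IsHomog deg σ w ∧ f w = y := by
  obtain ⟨w, rfl⟩ := hr
  exact ⟨homogComp K deg σ w, isHomog_homogComp _ _ _, by
    rw [map_homogComp hf, hy.homogComp_eq]⟩

/-- The usual lifting, with homogeneous preimages chosen for the basis elements. Preservation of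
degrees is what later forces the image of a cycle into the irrelevant part. -/
lemma exists_homogeneous_chainMap {I : Ideal (MvPolynomial ι K)} (hI : IsMonomialIdeal I)
    (F : MinimalFreeResolution (quotientGrading I)) {β : ℕ → Type*}
    (deg : ∀ i, β i → (ι →₀ ℕ))
    (d : ∀ i, (β (i + 1) →₀ MvPolynomial ι K) →ₗ[MvPolynomial ι K] (β i →₀ MvPolynomial ι K))
    (aug : (β 0 →₀ MvPolynomial ι K) →ₗ[MvPolynomial ι K] MvPolynomial ι K ⧸ I)
    (hd : ∀ i σ v, IsHomog (deg (i + 1)) σ v → IsHomog (deg i) σ (d i v))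
    (haug : ∀ b, aug (Finsupp.single b 1) ∈ quotientGrading I (deg 0 b))
    (hex0 : Function.Exact (d 0) aug) (hex : ∀ i, Function.Exact (d (i + 1)) (d i)) :
    ∃ φ : ∀ i, (β i →₀ MvPolynomial ι K) →ₗ[MvPolynomial ι K] (F.gen i →₀ MvPolynomial ι K),
      (∀ i σ v, IsHomog (deg i) σ v → IsHomog (F.deg i) σ (φ i v)) ∧
      F.aug.comp (φ 0) = aug ∧ ∀ i, (F.d i).comp (φ (i + 1)) = (φ i).comp (d i) := by
  let A : ∀ i, ((β i →₀ MvPolynomial ι K) →ₗ[MvPolynomial ι K]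
      (F.gen i →₀ MvPolynomial ι K)) → Prop := fun i f =>
    (∀ σ v, IsHomog (deg i) σ v → IsHomog (F.deg i) σ (f v)) ∧
    match i, f with
    | 0, f => F.aug.comp f = aug
    | i + 1, f => ∀ x, d i x = 0 → F.d i (f x) = 0
  have hsingle : ∀ i b, IsHomog (deg i) (deg i b) (Finsupp.single b (1 : MvPolynomial ι K)) :=
    fun i b => by simpa using isHomog_single_monomial (deg i) b 0 (1 : K)
  obtain ⟨φ, hφ⟩ := exists_dependent_seq (α := fun i => (β i →₀ MvPolynomial ι K)
      →ₗ[MvPolynomial ι K] (F.gen i →₀ MvPolynomial ι K)) A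
    (fun i f g => (F.d i).comp g = f.comp (d i))
    (by
      choose w hw hw' using fun b => F.exists_homogeneous_aug_eq hI (haug b)
      refine ⟨Finsupp.linearCombination _ w, fun σ v hv => isHomog_map (fun b => ?_) hv, ?_⟩
      · simpa using hw b
      · refine Finsupp.lhom_ext' fun b => LinearMap.ext_ring ?_
        simpa using hw' b)
    (fun i f hf => by
      have hr : ∀ p, f (d i p) ∈ Set.range (F.d i) := fun p => by
        cases i with
        | zero =>
          refine (F.exact_zero _).1 ?_
          have := LinearMap.congr_fun hf.2 (d 0 p)
          exact this.trans ((hex0 _).2 ⟨p, rfl⟩)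
        | succ i => exact (F.exact_succ i _).1 (hf.2 _ ((hex i _).2 ⟨p, rfl⟩))
      choose w hw hw' using fun b => exists_homogeneous_preimage (F.d_homog i)
        (hf.1 _ _ (hd i _ _ (hsingle (i + 1) b))) (hr _)
      have hcomp : (F.d i).comp (Finsupp.linearCombination _ w) = f.comp (d i) := by
        refine Finsupp.lhom_ext' fun b => LinearMap.ext_ring ?_
        simpa using hw' b
      refine ⟨Finsupp.linearCombination _ w, ⟨fun σ v hv => isHomog_map (fun b => ?_) hv,
        fun x hx => ?_⟩, hcomp⟩
      · simpa using hw b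
      · have := LinearMap.congr_fun hcomp x
        simpa [hx] using this)
  exact ⟨φ, fun i => (hφ i).1.1, (hφ 0).1.2, fun i => (hφ i).2⟩

/-- A homogeneous cycle modulo the irrelevant ideal in an arbitrary graded free resolution of `S / I`
that is detected by a cocycle `v ↦ v b` forces a generator of the same degree in every minimal
resolution. -/
lemma MinimalFreeResolution.exists_deg_eq_of_cycle {I : Ideal (MvPolynomial ι K)}
    (hI : IsMonomialIdeal I)
    (F : MinimalFreeResolution (quotientGrading I)) {β : ℕ → Type*}
    (deg : ∀ i, β i → (ι →₀ ℕ))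
    (d : ∀ i, (β (i + 1) →₀ MvPolynomial ι K) →ₗ[MvPolynomial ι K] (β i →₀ MvPolynomial ι K))
    (aug : (β 0 →₀ MvPolynomial ι K) →ₗ[MvPolynomial ι K] MvPolynomial ι K ⧸ I)
    (hd : ∀ i σ v, IsHomog (deg (i + 1)) σ v → IsHomog (deg i) σ (d i v))
    (haug : ∀ b, aug (Finsupp.single b 1) ∈ quotientGrading I (deg 0 b))
    (hsurj : Function.Surjective aug)
    (hex0 : Function.Exact (d 0) aug) (hex : ∀ i, Function.Exact (d (i + 1)) (d i))
    {s : ℕ} {σ : ι →₀ ℕ} {z : β s →₀ MvPolynomial ι K} (hz : IsHomog (deg s) σ z)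
    (hdz : ∀ t (e : s = t + 1), d t (e ▸ z) ∈
      irrelevant K ι • (⊤ : Submodule (MvPolynomial ι K) (β t →₀ MvPolynomial ι K)))
    {b : β s} (hb : ∀ w, constantCoeff (d s w b) = 0) (hzb : constantCoeff (z b) ≠ 0) :
    ∃ b', F.deg s b' = σ := by
  by_contra! hno
  obtain ⟨φ, hφ, hφ0, hφd⟩ := exists_homogeneous_chainMap hI F deg d aug hd haug hex0 hex
  obtain ⟨ψ, hψ0, hψd⟩ := exists_chainMap
    (P := fun i => F.gen i →₀ MvPolynomial ι K) (Q := fun i => β i →₀ MvPolynomial ι K)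
    F.d d F.aug aug F.exact_zero F.exact_succ hsurj hex0 hex
  obtain ⟨h, hh0, hh⟩ := exists_homotopy (P := fun i => β i →₀ MvPolynomial ι K) d aug hex0 hex
    (fun i => (ψ i).comp (φ i) - LinearMap.id)
    (by rw [LinearMap.comp_sub, ← LinearMap.comp_assoc, hψ0, hφ0, LinearMap.comp_id, sub_self])
    (fun i => by
      rw [LinearMap.comp_sub, ← LinearMap.comp_assoc, hψd, LinearMap.comp_assoc, hφd,
        LinearMap.sub_comp, LinearMap.comp_assoc, LinearMap.comp_id, LinearMap.id_comp])
  -- A nonzero constant coordinate of `φ s z`, which has degree `σ`, would sit at a generator of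
  -- degree `σ`.
  have hφz : φ s z ∈ irrelevant K ι • (⊤ : Submodule (MvPolynomial ι K) _) := by
    rw [mem_irrelevant_smul_top_iff]
    intro b'
    by_contra h0
    rw [constantCoeff_eq] at h0
    exact hno b' (by simpa using isHomog_iff.1 (hφ s σ z hz) b' 0 h0)
  have hψφz := mem_irrelevant_smul_top_iff.1 (map_mem_irrelevant_smul_top (ψ s) hφz) b
  refine hzb ?_
  -- Compare constant coefficients at `b` in `d h = ψ φ - id - h d`. For `s = 0` the term `h d` is
  -- absent; otherwise it vanishes since `d z` is zero modulo the variables.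
  cases s with
  | zero =>
    have h1 := DFunLike.congr_fun (LinearMap.congr_fun hh0 z) b
    have h2 := hb (h 0 z)
    simp only [LinearMap.comp_apply, LinearMap.sub_apply, LinearMap.id_apply,
      Finsupp.sub_apply] at h1
    rw [h1, map_sub, hψφz, zero_sub, neg_eq_zero] at h2
    exact h2
  | succ t =>
    have h1 := DFunLike.congr_fun (LinearMap.congr_fun (hh t) z) b
    have h2 := hb (h (t + 1) z)
    have h3 := mem_irrelevant_smul_top_iff.1 (map_mem_irrelevant_smul_top (h t) (hdz t rfl)) b
    simp only [LinearMap.comp_apply, LinearMap.sub_apply, LinearMap.id_apply,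
      Finsupp.sub_apply] at h1
    rw [h1, map_sub, map_sub, hψφz, h3, sub_zero, zero_sub, neg_eq_zero] at h2
    exact h2

end Betti

/-! ### The Lyubeznik resolution and maximal admissible symbols -/

section MinGens

variable {K ι Λ : Type*} [Field K]

lemma ListsMinGens.monomial_mem {I : Ideal (MvPolynomial ι K)} {m : Λ → (ι →₀ ℕ)}
    (hm : ListsMinGens I m) (j : Λ) : monomial (m j) (1 : K) ∈ I := by
  have h : m j ∈ minGens I := hm.2 ▸ Set.mem_range_self j
  exact h.1

lemma ListsMinGens.eq_of_le {I : Ideal (MvPolynomial ι K)} {m : Λ → (ι →₀ ℕ)}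
    (hm : ListsMinGens I m) {i j : Λ} (hij : m i ≤ m j) : i = j := by
  have h : m j ∈ minGens I := hm.2 ▸ Set.mem_range_self j
  exact hm.1 (le_antisymm hij (h.2 (hm.monomial_mem i) hij))

lemma ListsMinGens.exists_le [Finite ι] {I : Ideal (MvPolynomial ι K)} {m : Λ → (ι →₀ ℕ)}
    (hm : ListsMinGens I m) {a : ι →₀ ℕ} (ha : monomial a (1 : K) ∈ I) : ∃ j, m j ≤ a := by
  obtain ⟨b, hb, hmin⟩ := exists_minimal_le_of_wellFoundedLT
    (fun b => monomial b (1 : K) ∈ I) a ha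
  have : b ∈ minGens I := hmin
  rw [← hm.2] at this
  obtain ⟨j, rfl⟩ := this
  exact ⟨j, hb⟩

end MinGens

/-! ### The Lyubeznik complex as a graded free resolution of `S / I` -/

section LyubeznikResolution

variable {K ι Λ : Type*} [Field K] [LinearOrder Λ] [Fintype Λ]

/-- The differential modulo the variables, organized by the target face: a quotient of least common
multiples survives only if it is `1`. Only symbols properly containing `ρ` contribute, which is how
maximality enters. -/
lemma constantCoeff_taylorD (m : Λ → (ι →₀ ℕ)) (v : Finset Λ →₀ MvPolynomial ι K)
    (ρ : Finset Λ) :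
    constantCoeff (taylorD K m v ρ) = ∑ t with t ∉ ρ ∧ m t ≤ ρ.sup m,
      faceSign K ρ t * constantCoeff (v (insert t ρ)) := by
  classical
  induction v using Finsupp.induction_linear with
  | zero => simp
  | add f g hf hg => simp [hf, hg, mul_add, Finset.sum_add_distrib]
  | single τ p =>
    rw [taylorD_single, Finsupp.finsetSum_apply, map_sum, Finset.sum_filter,
      ← Finset.sum_filter_of_ne (s := Finset.univ) (p := fun t => t ∈ τ)]
    · rw [show (Finset.univ.filter fun t => t ∈ τ) = τ by ext; simp]
      refine Finset.sum_congr rfl fun t ht => ?_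
      by_cases h : τ.erase t = ρ
      · have hins : insert t ρ = τ := by rw [← h, Finset.insert_erase ht]
        have hnot : t ∉ ρ := by rw [← h]; exact Finset.notMem_erase t τ
        rw [h, Finsupp.single_eq_same, hins, Finsupp.single_eq_same, map_mul]
        have hsup : τ.sup m - ρ.sup m = 0 ↔ m t ≤ ρ.sup m := by
          rw [tsub_eq_zero_iff_le, ← hins, Finset.sup_insert]
          simp
        by_cases hle : m t ≤ ρ.sup m
        · rw [hsup.2 hle, if_pos ⟨hnot, hle⟩, ← C_apply, constantCoeff_C, mul_comm, ← hins,
            faceSign_insert_of_not_lt (lt_irrefl t)]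
        · rw [if_neg fun h => hle h.2, constantCoeff_monomial, if_neg fun h => hle (hsup.1 h),
            mul_zero]
      · rw [Finsupp.single_eq_of_ne (Ne.symm h), map_zero]
        split_ifs with h2
        · rw [Finsupp.single_eq_of_ne, map_zero, mul_zero]
          rintro rfl
          exact h (Finset.erase_insert h2.1)
        · rfl
    · intro t _ hne
      by_contra ht
      refine hne ?_
      split_ifs
      · rw [Finsupp.single_eq_of_ne, map_zero, mul_zero]
        rintro rfl
        exact ht (Finset.mem_insert_self t ρ)
      · rfl

/-- The `L`-admissible symbols with `s` elements, as a type. -/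
abbrev LyubeznikGen (m : Λ → (ι →₀ ℕ)) (s : ℕ) : Type _ :=
  ↥(admissibleSymbols m s : Set (Finset Λ))

/-- The identification of `L_s` with the free module on the admissible symbols. -/
def lyubeznikEquiv (K : Type*) [Field K] (m : Λ → (ι →₀ ℕ)) (s : ℕ) :
    lyubeznik K m s ≃ₗ[MvPolynomial ι K] (LyubeznikGen m s →₀ MvPolynomial ι K) :=
  Finsupp.supportedEquivFinsupp _

lemma lyubeznikEquiv_apply (m : Λ → (ι →₀ ℕ)) (s : ℕ) (v : lyubeznik K m s)
    (τ : LyubeznikGen m s) : lyubeznikEquiv K m s v τ = v.1 τ.1 := rfl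

lemma lyubeznikEquiv_symm_apply (m : Λ → (ι →₀ ℕ)) (s : ℕ)
    (v : LyubeznikGen m s →₀ MvPolynomial ι K) (τ : LyubeznikGen m s) :
    ((lyubeznikEquiv K m s).symm v).1 τ.1 = v τ := by
  rw [← lyubeznikEquiv_apply, LinearEquiv.apply_symm_apply]

lemma lyubeznikEquiv_symm_single (m : Λ → (ι →₀ ℕ)) (s : ℕ) (τ : LyubeznikGen m s)
    (p : MvPolynomial ι K) :
    ((lyubeznikEquiv K m s).symm (Finsupp.single τ p)).1 = Finsupp.single τ.1 p :=
  Finsupp.supportedEquivFinsupp_symm_single _ _ _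

/-- The differential of the Lyubeznik complex. -/
def lyubeznikD (K : Type*) [Field K] (m : Λ → (ι →₀ ℕ)) (s : ℕ) :
    (LyubeznikGen m (s + 1) →₀ MvPolynomial ι K) →ₗ[MvPolynomial ι K]
      (LyubeznikGen m s →₀ MvPolynomial ι K) :=
  (lyubeznikEquiv K m s).toLinearMap.comp
    (((taylorD K m).restrict fun _ => taylorD_mem_lyubeznik).comp
      (lyubeznikEquiv K m (s + 1)).symm.toLinearMap)

lemma lyubeznikD_apply (m : Λ → (ι →₀ ℕ)) (s : ℕ)
    (v : LyubeznikGen m (s + 1) →₀ MvPolynomial ι K) (τ : LyubeznikGen m s) :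
    lyubeznikD K m s v τ = taylorD K m ((lyubeznikEquiv K m (s + 1)).symm v).1 τ.1 := rfl

lemma lyubeznikEquiv_symm_lyubeznikD (m : Λ → (ι →₀ ℕ)) (s : ℕ)
    (v : LyubeznikGen m (s + 1) →₀ MvPolynomial ι K) :
    ((lyubeznikEquiv K m s).symm (lyubeznikD K m s v)).1 =
      taylorD K m ((lyubeznikEquiv K m (s + 1)).symm v).1 := by
  simp [lyubeznikD]

lemma isHomog_lyubeznikEquiv_symm_iff {m : Λ → (ι →₀ ℕ)} {s : ℕ} {σ : ι →₀ ℕ}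
    {v : LyubeznikGen m s →₀ MvPolynomial ι K} :
    IsHomog (fun τ => τ.sup m) σ ((lyubeznikEquiv K m s).symm v).1 ↔
      IsHomog (fun τ : LyubeznikGen m s => τ.1.sup m) σ v := by
  simp only [isHomog_iff]
  constructor
  · intro h τ a ha
    exact h τ.1 a (by rwa [lyubeznikEquiv_symm_apply])
  · intro h τ a ha
    have hτ : τ ∈ admissibleSymbols m s := by
      refine mem_lyubeznik.1 ((lyubeznikEquiv K m s).symm v).2 τ fun h0 => ha ?_
      rw [h0, coeff_zero]
    exact h ⟨τ, hτ⟩ a (by rwa [← lyubeznikEquiv_symm_apply])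

lemma isHomog_lyubeznikD {m : Λ → (ι →₀ ℕ)} {s : ℕ} {σ : ι →₀ ℕ}
    {v : LyubeznikGen m (s + 1) →₀ MvPolynomial ι K}
    (hv : IsHomog (fun τ : LyubeznikGen m (s + 1) => τ.1.sup m) σ v) :
    IsHomog (fun τ : LyubeznikGen m s => τ.1.sup m) σ (lyubeznikD K m s v) := by
  rw [← isHomog_lyubeznikEquiv_symm_iff, lyubeznikEquiv_symm_lyubeznikD]
  exact isHomog_taylorD m (isHomog_lyubeznikEquiv_symm_iff.2 hv)

lemma exact_lyubeznikD (m : Λ → (ι →₀ ℕ)) (s : ℕ) :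
    Function.Exact (lyubeznikD K m (s + 1)) (lyubeznikD K m s) := by
  have key : ∀ (t : ℕ) (v w : LyubeznikGen m t →₀ MvPolynomial ι K),
      ((lyubeznikEquiv K m t).symm v).1 = ((lyubeznikEquiv K m t).symm w).1 → v = w :=
    fun t v w h => (lyubeznikEquiv K m t).symm.injective (Subtype.ext h)
  intro v
  constructor
  · intro hv
    have hd : taylorD K m ((lyubeznikEquiv K m (s + 1)).symm v).1 = 0 := by
      rw [← lyubeznikEquiv_symm_lyubeznikD, hv, map_zero]
      rfl
    obtain ⟨w, hw, hwv⟩ := exists_taylorD_eq ((lyubeznikEquiv K m (s + 1)).symm v).2 hd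
    refine ⟨lyubeznikEquiv K m (s + 2) ⟨w, hw⟩, key _ _ _ ?_⟩
    rw [lyubeznikEquiv_symm_lyubeznikD, LinearEquiv.symm_apply_apply]
    exact hwv
  · rintro ⟨w, rfl⟩
    refine key _ _ _ ?_
    rw [lyubeznikEquiv_symm_lyubeznikD, lyubeznikEquiv_symm_lyubeznikD, taylorD_taylorD, map_zero]
    rfl

lemma empty_mem_admissibleSymbols (m : Λ → (ι →₀ ℕ)) : ∅ ∈ admissibleSymbols m 0 := by
  simp [mem_admissibleSymbols, LAdmissible]

lemma singleton_mem_admissibleSymbols (m : Λ → (ι →₀ ℕ)) (q : Λ) :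
    {q} ∈ admissibleSymbols m 1 := by
  simp [mem_admissibleSymbols, LAdmissible]

lemma lyubeznikGen_zero_eq (m : Λ → (ι →₀ ℕ)) (τ : LyubeznikGen m 0) :
    τ = ⟨∅, empty_mem_admissibleSymbols m⟩ :=
  Subtype.ext (Finset.card_eq_zero.1 (mem_admissibleSymbols.1 τ.2).1)

/-- The augmentation of the Lyubeznik complex. -/
def lyubeznikAug (I : Ideal (MvPolynomial ι K)) (m : Λ → (ι →₀ ℕ)) :
    (LyubeznikGen m 0 →₀ MvPolynomial ι K) →ₗ[MvPolynomial ι K] MvPolynomial ι K ⧸ I :=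
  (Submodule.mkQ I).comp (Finsupp.lapply ⟨∅, empty_mem_admissibleSymbols m⟩)

/-- The singletons map to the generators `m q`, and every monomial of `I` is a multiple of one of
them. -/
lemma exact_lyubeznikAug [Finite ι] {I : Ideal (MvPolynomial ι K)} (hI : IsMonomialIdeal I)
    {m : Λ → (ι →₀ ℕ)} (hm : ListsMinGens I m) :
    Function.Exact (lyubeznikD K m 0) (lyubeznikAug I m) := by
  have hD : ∀ (τ : LyubeznikGen m 1) (p : MvPolynomial ι K), ∃ q,
      lyubeznikD K m 0 (Finsupp.single τ p) =
      Finsupp.single ⟨∅, empty_mem_admissibleSymbols m⟩ (p * monomial (m q) 1) ∧ τ.1 = {q} := by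
    rintro ⟨τ, hτ⟩ p
    obtain ⟨q, rfl⟩ := Finset.card_eq_one.1 (mem_admissibleSymbols.1 hτ).1
    refine ⟨q, Finsupp.ext fun τ' => ?_, rfl⟩
    rw [lyubeznikGen_zero_eq m τ', Finsupp.single_eq_same, lyubeznikD_apply,
      lyubeznikEquiv_symm_single, taylorD_single]
    simp [faceSign, Finset.filter_singleton, bot_eq_zero]
  intro v
  have haug : lyubeznikAug I m v = 0 ↔ v ⟨∅, empty_mem_admissibleSymbols m⟩ ∈ I := by
    simp [lyubeznikAug, Ideal.Quotient.eq_zero_iff_mem]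
  rw [haug]
  constructor
  · intro hv
    have hv' : v = Finsupp.single ⟨∅, empty_mem_admissibleSymbols m⟩
        (v ⟨∅, empty_mem_admissibleSymbols m⟩) := by
      refine Finsupp.ext fun τ => ?_
      rw [lyubeznikGen_zero_eq m τ, Finsupp.single_eq_same]
    change v ∈ LinearMap.range (lyubeznikD K m 0)
    rw [hv', (v _).as_sum, Finsupp.single_finsetSum]
    refine Submodule.sum_mem _ fun a ha => ?_
    obtain ⟨j, hj⟩ := hm.exists_le (hI.monomial_one_mem hv (mem_support_iff.1 ha))
    refine ⟨Finsupp.single ⟨{j}, singleton_mem_admissibleSymbols m j⟩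
      (monomial (a - m j) (coeff a (v ⟨∅, empty_mem_admissibleSymbols m⟩))), ?_⟩
    obtain ⟨q, hq, hjq⟩ := hD ⟨{j}, singleton_mem_admissibleSymbols m j⟩
      (monomial (a - m j) (coeff a (v ⟨∅, empty_mem_admissibleSymbols m⟩)))
    have : j = q := Finset.singleton_injective hjq
    subst this
    rw [hq, monomial_mul, mul_one, tsub_add_cancel_of_le hj]
  · rintro ⟨w, rfl⟩
    clear haug
    induction w using Finsupp.induction_linear with
    | zero => simp
    | add f g hf hg =>
      rw [map_add, Finsupp.add_apply]
      exact I.add_mem hf hg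
    | single τ p =>
      obtain ⟨q, hq, -⟩ := hD τ p
      rw [hq, Finsupp.single_eq_same]
      exact I.mul_mem_left _ (hm.monomial_mem q)

/-- A maximal admissible symbol occurring in a cycle of `L ⊗ K` of degree `σ` gives a nonzero
multigraded Betti number. -/
theorem gradedBetti_ne_zero_of_cycle [Finite ι] {I : Ideal (MvPolynomial ι K)}
    (hI : IsMonomialIdeal I) {m : Λ → (ι →₀ ℕ)} (hm : ListsMinGens I m) {s : ℕ} {σ : ι →₀ ℕ}
    {τ : Finset Λ} (hmax : NoLargerLAdmissible m τ) {c : Finset Λ → K}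
    (hc : ∀ ρ, c ρ ≠ 0 → ρ ∈ admissibleSymbols m s ∧ ρ.sup m = σ)
    (hcycle : ∀ ρ, ∑ t with t ∉ ρ ∧ m t ≤ ρ.sup m, faceSign K ρ t * c (insert t ρ) = 0)
    (hcτ : c τ ≠ 0) : gradedBetti (quotientGrading I) s σ ≠ 0 := by
  classical
  -- Without a minimal resolution the infimum would be `0`; with one it is attained by some `F`.
  have hne : {n | ∃ F : MinimalFreeResolution (quotientGrading I), F.betti s σ = n}.Nonempty := by
    obtain ⟨F⟩ := exists_minimalFreeResolution_quotient hI
    exact ⟨_, F, rfl⟩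
  obtain ⟨F, hF⟩ := Nat.sInf_mem hne
  rw [gradedBetti, ← hF]
  let Z : Finset Λ →₀ MvPolynomial ι K := Finsupp.equivFunOnFinite.symm fun ρ => C (c ρ)
  have hZ : ∀ ρ, Z ρ = C (c ρ) := fun _ => rfl
  have hZL : Z ∈ lyubeznik K m s := mem_lyubeznik.2 fun ρ hρ =>
    (hc ρ fun h0 => hρ (by rw [hZ, h0, C_0])).1
  have hZhom : IsHomog (fun ρ : Finset Λ => ρ.sup m) σ Z := by
    rw [isHomog_iff]
    intro ρ a ha
    rw [hZ, coeff_C] at ha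
    split_ifs at ha with h0
    · rw [← h0, zero_add]
      exact (hc ρ ha).2
    · exact absurd rfl ha
  have hZd : ∀ ρ, constantCoeff (taylorD K m Z ρ) = 0 := fun ρ => by
    rw [constantCoeff_taylorD]
    simpa only [hZ, constantCoeff_C] using hcycle ρ
  obtain ⟨b, hb⟩ := F.exists_deg_eq_of_cycle hI (β := LyubeznikGen m)
    (fun i τ => τ.1.sup m) (lyubeznikD K m) (lyubeznikAug I m)
    (fun i σ v hv => isHomog_lyubeznikD hv)
    (fun b => ⟨monomial 0 1, ⟨1, by rw [lyubeznikGen_zero_eq m b]; simp [bot_eq_zero]⟩, by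
      rw [lyubeznikGen_zero_eq m b]; simp [lyubeznikAug]⟩)
    (fun x => by
      obtain ⟨p, rfl⟩ := Ideal.Quotient.mk_surjective x
      exact ⟨Finsupp.single ⟨∅, empty_mem_admissibleSymbols m⟩ p, by simp [lyubeznikAug]⟩)
    (exact_lyubeznikAug hI hm) (exact_lyubeznikD m)
    (z := lyubeznikEquiv K m s ⟨Z, hZL⟩) (s := s) (σ := σ)
    (isHomog_lyubeznikEquiv_symm_iff.1 (by rwa [LinearEquiv.symm_apply_apply]))
    (fun t e => by
      subst e
      rw [mem_irrelevant_smul_top_iff]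
      intro ρ
      rw [lyubeznikD_apply, LinearEquiv.symm_apply_apply]
      exact hZd ρ.1)
    (b := ⟨τ, (hc τ hcτ).1⟩)
    -- Every contribution to a boundary at `τ` comes from some `insert t τ`, which maximality makes
    -- inadmissible.
    (fun w => by
      rw [lyubeznikD_apply, constantCoeff_taylorD]
      refine Finset.sum_eq_zero fun t ht => ?_
      rw [Finset.mem_filter] at ht
      have : ((lyubeznikEquiv K m (s + 1)).symm w).1 (insert t τ) = 0 := by
        by_contra h0
        exact hmax _ (Finset.ssubset_insert ht.2.1)
          (mem_admissibleSymbols.1 (mem_lyubeznik.1 ((lyubeznikEquiv K m (s + 1)).symm w).2 _ h0)).2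
      rw [this, map_zero, mul_zero])
    (by rw [lyubeznikEquiv_apply, hZ, constantCoeff_C]; exact hcτ)
  have := F.finite_gen s
  have : Nonempty {b : F.gen s // F.deg s b = σ} := ⟨⟨b, hb⟩⟩
  exact Nat.card_pos.ne'

end LyubeznikResolution

/-! ### Sums of monomial ideals -/

section SumIdeal

variable {K : Type*} [Field K]

lemma IsMonomialIdeal.sup {ι : Type*} {I J : Ideal (MvPolynomial ι K)} (hI : IsMonomialIdeal I)
    (hJ : IsMonomialIdeal J) : IsMonomialIdeal (I ⊔ J) := by
  obtain ⟨A, rfl⟩ := hI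
  obtain ⟨B, rfl⟩ := hJ
  exact ⟨A ∪ B, by rw [Set.image_union, Ideal.span_union]⟩

lemma IsMonomialIdeal.iSup {ι κ : Type*} {I : κ → Ideal (MvPolynomial ι K)}
    (hI : ∀ k, IsMonomialIdeal (I k)) : IsMonomialIdeal (⨆ k, I k) := by
  choose A hA using hI
  refine ⟨⋃ k, A k, ?_⟩
  rw [Set.image_iUnion, Ideal.span, Submodule.span_iUnion]
  exact iSup_congr hA

lemma IsMonomialIdeal.map_rename {ι κ : Type*} {I : Ideal (MvPolynomial ι K)}
    (hI : IsMonomialIdeal I) (f : ι → κ) :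
    IsMonomialIdeal (I.map (rename f : MvPolynomial ι K →ₐ[K] MvPolynomial κ K)) := by
  obtain ⟨A, rfl⟩ := hI
  refine ⟨Finsupp.mapDomain f '' A, ?_⟩
  rw [Ideal.map_span, Set.image_image, Set.image_image]
  simp only [rename_monomial]

lemma isMonomialIdeal_sumIdeal {r : ℕ} {N : Fin r → ℕ}
    {I : ∀ k, Ideal (MvPolynomial (Fin (N k)) K)} (hI : ∀ k, IsMonomialIdeal (I k))
    {J : Ideal (MvPolynomial (Σ k, Fin (N k)) K)} (hJ : IsMonomialIdeal J) :
    IsMonomialIdeal (sumIdeal I J) :=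
  (IsMonomialIdeal.iSup fun k => (hI k).map_rename _).sup hJ

end SumIdeal

/-! ### Concatenated lists -/

section Concat

variable {r : ℕ} {N μ : Fin r → ℕ} {ν : ℕ}

/-- The position of the `j`-th element of the `k`-th block. -/
def blockIndex (ν : ℕ) (k : Fin r) (j : Fin (μ k)) : ConcatIndex μ ν :=
  toLex (Sum.inl (toLex ⟨k, j⟩))

/-- The position of the `x`-th element of the last block. -/
def lastIndex (μ : Fin r → ℕ) (x : Fin ν) : ConcatIndex μ ν :=
  toLex (Sum.inr x)

lemma concatIndex_cases (q : ConcatIndex μ ν) :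
    (∃ k j, q = blockIndex ν k j) ∨ ∃ x, q = lastIndex μ x := by
  rcases h : ofLex q with p | x
  · exact Or.inl ⟨(ofLex p).1, (ofLex p).2, by rw [← toLex_ofLex q, h]; rfl⟩
  · exact Or.inr ⟨x, by rw [← toLex_ofLex q, h]; rfl⟩

lemma blockIndex_inj {k : Fin r} {i j : Fin (μ k)} :
    blockIndex ν k i = blockIndex ν k j ↔ i = j := by
  simp [blockIndex]

lemma blockIndex_ne {k l : Fin r} (h : k ≠ l) (i : Fin (μ k)) (j : Fin (μ l)) :
    blockIndex ν k i ≠ blockIndex ν l j := by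
  intro e
  simp [blockIndex, h] at e

lemma blockIndex_ne_lastIndex {k : Fin r} (i : Fin (μ k)) (x : Fin ν) :
    blockIndex ν k i ≠ lastIndex μ x := by
  intro e
  simp [blockIndex, lastIndex] at e

lemma blockIndex_lt_lastIndex {k : Fin r} (i : Fin (μ k)) (x : Fin ν) :
    blockIndex ν k i < lastIndex μ x :=
  Sum.Lex.inl_lt_inr _ _

lemma blockIndex_lt_of_lt {k l : Fin r} (h : k < l) (i : Fin (μ k)) (j : Fin (μ l)) :
    blockIndex ν k i < blockIndex ν l j :=
  Sum.Lex.inl_lt_inl_iff.2 (Sigma.Lex.left _ _ h)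

lemma blockIndex_lt_iff {k : Fin r} {i j : Fin (μ k)} :
    blockIndex ν k i < blockIndex ν k j ↔ i < j := by
  rw [blockIndex, blockIndex, Sum.Lex.inl_lt_inl_iff, Sigma.Lex.lt_def]
  constructor
  · rintro (h | ⟨_, h⟩)
    · exact absurd h (lt_irrefl _)
    · exact h
  · exact fun h => Or.inr ⟨rfl, h⟩

lemma blockIndex_le_iff {k : Fin r} {i j : Fin (μ k)} :
    blockIndex ν k i ≤ blockIndex ν k j ↔ i ≤ j := by
  rw [← not_lt, ← not_lt, blockIndex_lt_iff]

lemma sum_concatIndex {A : Type*} [AddCommMonoid A] (f : ConcatIndex μ ν → A) :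
    ∑ q, f q = ∑ k, ∑ j, f (blockIndex ν k j) + ∑ x, f (lastIndex μ x) := by
  rw [← toLex.sum_comp f, Fintype.sum_sum_type, ← toLex.sum_comp, Fintype.sum_sigma]
  rfl

lemma mem_prodSymbol {τ : ∀ k, Finset (Fin (μ k))} {q : ConcatIndex μ ν} :
    q ∈ prodSymbol ν τ ↔ ∃ k, ∃ j ∈ τ k, q = blockIndex ν k j := by
  rw [prodSymbol, Finset.mem_map]
  constructor
  · rintro ⟨⟨k, j⟩, h, rfl⟩
    exact ⟨k, j, by simpa using h, rfl⟩
  · rintro ⟨k, j, h, rfl⟩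
    exact ⟨⟨k, j⟩, by simpa using h, rfl⟩

lemma blockIndex_mem_prodSymbol {τ : ∀ k, Finset (Fin (μ k))} {k : Fin r} {j : Fin (μ k)} :
    blockIndex ν k j ∈ prodSymbol ν τ ↔ j ∈ τ k := by
  rw [mem_prodSymbol]
  constructor
  · rintro ⟨l, i, hi, h⟩
    obtain rfl : k = l := by
      by_contra hne
      exact blockIndex_ne hne _ _ h
    rwa [blockIndex_inj.1 h]
  · exact fun h => ⟨k, j, h, rfl⟩

lemma lastIndex_notMem_prodSymbol (τ : ∀ k, Finset (Fin (μ k))) (x : Fin ν) :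
    lastIndex μ x ∉ prodSymbol ν τ := by
  rw [mem_prodSymbol]
  rintro ⟨k, j, -, h⟩
  exact blockIndex_ne_lastIndex _ _ h.symm

lemma card_prodSymbol (τ : ∀ k, Finset (Fin (μ k))) :
    (prodSymbol ν τ).card = ∑ k, (τ k).card := by
  rw [prodSymbol, Finset.card_map, Finset.card_sigma]

/-- The part of a symbol in the `k`-th block. -/
def blockPart (ρ : Finset (ConcatIndex μ ν)) (k : Fin r) : Finset (Fin (μ k)) :=
  Finset.univ.filter fun j => blockIndex ν k j ∈ ρ

lemma mem_blockPart {ρ : Finset (ConcatIndex μ ν)} {k : Fin r} {j : Fin (μ k)} :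
    j ∈ blockPart ρ k ↔ blockIndex ν k j ∈ ρ := by
  simp [blockPart]

lemma blockPart_prodSymbol (τ : ∀ k, Finset (Fin (μ k))) (k : Fin r) :
    blockPart (prodSymbol ν τ) k = τ k := by
  ext j
  rw [mem_blockPart, blockIndex_mem_prodSymbol]

lemma prodSymbol_blockPart {ρ : Finset (ConcatIndex μ ν)} (hρ : ∀ x, lastIndex μ x ∉ ρ) :
    prodSymbol ν (blockPart ρ) = ρ := by
  ext q
  rcases concatIndex_cases q with ⟨k, j, rfl⟩ | ⟨x, rfl⟩
  · rw [blockIndex_mem_prodSymbol, mem_blockPart]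
  · exact iff_of_false (lastIndex_notMem_prodSymbol _ x) (hρ x)

lemma blockPart_insert_self (ρ : Finset (ConcatIndex μ ν)) (k : Fin r) (j : Fin (μ k)) :
    blockPart (insert (blockIndex ν k j) ρ) k = insert j (blockPart ρ k) := by
  ext i
  rw [mem_blockPart, Finset.mem_insert, Finset.mem_insert, blockIndex_inj, mem_blockPart]

lemma blockPart_insert_of_ne (ρ : Finset (ConcatIndex μ ν)) {k l : Fin r} (h : l ≠ k)
    (j : Fin (μ k)) : blockPart (insert (blockIndex ν k j) ρ) l = blockPart ρ l := by
  ext i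
  rw [mem_blockPart, Finset.mem_insert, mem_blockPart, or_iff_right (blockIndex_ne h _ _)]

/-- The sign of the Leibniz rule: the elements of earlier blocks contribute a factor that does not
depend on `j`. -/
lemma faceSign_blockIndex (K : Type*) [Field K] (ρ : Finset (ConcatIndex μ ν)) (k : Fin r)
    (j : Fin (μ k)) :
    faceSign K ρ (blockIndex ν k j) =
      (-1) ^ (ρ.filter fun u => ∀ i : Fin (μ k), u < blockIndex ν k i).card *
        faceSign K (blockPart ρ k) j := by
  rw [faceSign, faceSign, ← pow_add,
    ← Finset.card_filter_add_card_filter_not (s := ρ.filter fun u => u < blockIndex ν k j)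
      (fun u => ∀ i : Fin (μ k), u < blockIndex ν k i), Finset.filter_filter,
    Finset.filter_filter]
  congr 2
  · congr 1
    ext u
    simp only [Finset.mem_filter]
    exact ⟨fun h => ⟨h.1, h.2.2⟩, fun h => ⟨h.1, h.2 j, h.2⟩⟩
  · rw [← Finset.card_map ⟨blockIndex ν k, fun _ _ h => blockIndex_inj.1 h⟩]
    congr 1
    ext u
    simp only [Finset.mem_filter, Finset.mem_map, mem_blockPart]
    constructor
    · rintro ⟨hu, hlt, hn⟩
      rcases concatIndex_cases u with ⟨l, i, rfl⟩ | ⟨x, rfl⟩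
      · rcases lt_trichotomy l k with h | rfl | h
        · exact absurd (fun i' => blockIndex_lt_of_lt h i i') hn
        · exact ⟨i, ⟨hu, blockIndex_lt_iff.1 hlt⟩, rfl⟩
        · exact absurd hlt (blockIndex_lt_of_lt h j i).not_gt
      · exact absurd hlt (blockIndex_lt_lastIndex j x).not_gt
    · rintro ⟨i, ⟨hi, hij⟩, rfl⟩
      exact ⟨hi, blockIndex_lt_iff.2 hij, fun h => lt_irrefl _ (h i)⟩

lemma mapDomain_le_concatDeg_iff {σ : ∀ k, Fin (N k) →₀ ℕ} {k : Fin r} {b : Fin (N k) →₀ ℕ} :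
    b.mapDomain (Sigma.mk k) ≤ concatDeg σ ↔ b ≤ σ k := by
  have hinj : Function.Injective fun i : Fin (N k) => (⟨k, i⟩ : Σ k, Fin (N k)) :=
    fun _ _ h => by simpa using h
  constructor
  · intro h i
    have := h ⟨k, i⟩
    rwa [Finsupp.mapDomain_apply hinj] at this
  · rintro h ⟨l, i⟩
    by_cases hl : k = l
    · subst hl
      rw [Finsupp.mapDomain_apply hinj]
      exact h i
    · rw [Finsupp.mapDomain_of_notMem_range]
      · exact Nat.zero_le _
      · rintro ⟨j, hj⟩
        exact hl (congrArg Sigma.fst hj)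

lemma concatGens_blockIndex (m : ∀ k, Fin (μ k) → (Fin (N k) →₀ ℕ))
    (c : Fin ν → ((Σ k, Fin (N k)) →₀ ℕ)) (k : Fin r) (j : Fin (μ k)) :
    concatGens m c (blockIndex ν k j) = (m k j).mapDomain (Sigma.mk k) := rfl

lemma sup_prodSymbol (m : ∀ k, Fin (μ k) → (Fin (N k) →₀ ℕ))
    (c : Fin ν → ((Σ k, Fin (N k)) →₀ ℕ)) (τ : ∀ k, Finset (Fin (μ k))) :
    (prodSymbol ν τ).sup (concatGens m c) = concatDeg fun k => (τ k).sup (m k) := by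
  refine le_antisymm (Finset.sup_le fun q hq => ?_) ?_
  · obtain ⟨k, j, hj, rfl⟩ := mem_prodSymbol.1 hq
    rw [concatGens_blockIndex, mapDomain_le_concatDeg_iff]
    exact Finset.le_sup hj
  · rintro ⟨k, i⟩
    -- Every multidegree is a concatenation, so the supremum can be compared block by block.
    have hS : ∃ S : ∀ k, Fin (N k) →₀ ℕ,
        (prodSymbol ν τ).sup (concatGens m c) = concatDeg S :=
      ⟨fun k => Finsupp.equivFunOnFinite.symm fun i =>
        (prodSymbol ν τ).sup (concatGens m c) ⟨k, i⟩, Finsupp.ext fun _ => rfl⟩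
    obtain ⟨S, hS⟩ := hS
    rw [hS]
    have h : (τ k).sup (m k) ≤ S k := Finset.sup_le fun j hj => by
      rw [← mapDomain_le_concatDeg_iff, ← hS, ← concatGens_blockIndex m c]
      exact Finset.le_sup (f := concatGens m c) (blockIndex_mem_prodSymbol.2 hj)
    exact h i

/-- The tail of the product at an element of block `k` involves no variables of earlier blocks, so
an earlier-block generator dividing it would be `1`, contrary to minimality. Within block `k` the
tail is that of `τ k`. The last element of `τ k` need not be last in the product; there a divisor
would divide a single generator, again contrary to minimality. -/
lemma lAdmissible_prodSymbol {K : Type*} [Field K] {m : ∀ k, Fin (μ k) → (Fin (N k) →₀ ℕ)}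
    {c : Fin ν → ((Σ k, Fin (N k)) →₀ ℕ)} {I : Ideal (MvPolynomial (Σ k, Fin (N k)) K)}
    (hI : ListsMinGens I (concatGens m c)) {τ : ∀ k, Finset (Fin (μ k))}
    (hτ : ∀ k, LAdmissible (m k) (τ k)) : LAdmissible (concatGens m c) (prodSymbol ν τ) := by
  rintro t ht - q hqt hle
  obtain ⟨k, j, hj, rfl⟩ := mem_prodSymbol.1 ht
  have hfilter : (prodSymbol ν τ).filter (fun u => blockIndex ν k j ≤ u) =
      prodSymbol ν fun l => (τ l).filter fun i => blockIndex ν k j ≤ blockIndex ν l i := by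
    ext u
    rcases concatIndex_cases u with ⟨l, i, rfl⟩ | ⟨x, rfl⟩
    · simp only [Finset.mem_filter, blockIndex_mem_prodSymbol]
    · simp only [Finset.mem_filter, lastIndex_notMem_prodSymbol, false_and]
  rw [hfilter, sup_prodSymbol] at hle
  rcases concatIndex_cases q with ⟨l, i, rfl⟩ | ⟨x, rfl⟩
  · rcases lt_trichotomy l k with h | rfl | h
    · rw [concatGens_blockIndex, mapDomain_le_concatDeg_iff, Finset.filter_false_of_mem
        fun i' _ => not_le.2 (blockIndex_lt_of_lt h i' j), Finset.sup_empty, le_bot_iff] at hle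
      refine hqt.ne (hI.eq_of_le ?_)
      rw [concatGens_blockIndex, hle, bot_eq_zero, Finsupp.mapDomain_zero]
      exact zero_le
    · have hle' := hle
      rw [concatGens_blockIndex, mapDomain_le_concatDeg_iff] at hle'
      simp only [blockIndex_le_iff] at hle'
      rw [blockIndex_lt_iff] at hqt
      by_cases hu : ∃ u ∈ τ l, j < u
      · exact hτ l j hj hu i hqt hle'
      · refine hqt.ne (blockIndex_inj (ν := ν).1 (hI.eq_of_le ?_))
        rw [concatGens_blockIndex, concatGens_blockIndex]
        refine Finsupp.mapDomain_mono (hle'.trans (Finset.sup_le fun u hmem => ?_))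
        obtain ⟨hu1, hu2⟩ := Finset.mem_filter.1 hmem
        push Not at hu
        rw [le_antisymm (hu u hu1) hu2]
    · exact absurd hqt (blockIndex_lt_of_lt h j i).not_gt
  · exact absurd hqt (blockIndex_lt_lastIndex j x).not_gt

/-- The product of cochains on the blocks, extended by zero to the symbols that meet the last
block. -/
def prodCoeff {K : Type*} [Field K] (c : ∀ k, Finset (Fin (μ k)) → K)
    (ρ : Finset (ConcatIndex μ ν)) : K :=
  open scoped Classical in
  if ∀ x, lastIndex μ x ∉ ρ then ∏ k, c k (blockPart ρ k) else 0

/-- The Leibniz rule: the terms with `t` in block `k` sum to a multiple of the cycle equation of `c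
k` at `blockPart ρ k`. Terms whose symbol meets the last block vanish by definition. -/
lemma prodCoeff_cycle {K : Type*} [Field K] (m : ∀ k, Fin (μ k) → (Fin (N k) →₀ ℕ))
    (g : Fin ν → ((Σ k, Fin (N k)) →₀ ℕ)) {c : ∀ k, Finset (Fin (μ k)) → K}
    (hc : ∀ k ρ, ∑ t with t ∉ ρ ∧ m k t ≤ ρ.sup (m k), faceSign K ρ t * c k (insert t ρ) = 0)
    (ρ : Finset (ConcatIndex μ ν)) :
    ∑ t with t ∉ ρ ∧ concatGens m g t ≤ ρ.sup (concatGens m g),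
      faceSign K ρ t * prodCoeff c (insert t ρ) = 0 := by
  classical
  by_cases hρ : ∀ x, lastIndex μ x ∉ ρ
  · rw [Finset.sum_filter, sum_concatIndex, Finset.sum_eq_zero, zero_add]
    · refine Finset.sum_eq_zero fun x _ => ?_
      have : prodCoeff c (insert (lastIndex μ x) ρ) = 0 :=
        if_neg fun h => h x (Finset.mem_insert_self _ _)
      rw [this, mul_zero, ite_self]
    · intro k _
      have hsup : ρ.sup (concatGens m g) = concatDeg fun k => (blockPart ρ k).sup (m k) := by
        rw [← sup_prodSymbol m g, prodSymbol_blockPart hρ]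
      rw [hsup]
      have hk := hc k (blockPart ρ k)
      rw [Finset.sum_filter] at hk
      suffices h : ∀ j, (if blockIndex ν k j ∉ ρ ∧ concatGens m g (blockIndex ν k j) ≤
            concatDeg fun k => (blockPart ρ k).sup (m k) then
          faceSign K ρ (blockIndex ν k j) * prodCoeff c (insert (blockIndex ν k j) ρ) else 0) =
          ((-1) ^ (ρ.filter fun u => ∀ i : Fin (μ k), u < blockIndex ν k i).card *
            ∏ l ∈ Finset.univ.erase k, c l (blockPart ρ l)) *
          if j ∉ blockPart ρ k ∧ m k j ≤ (blockPart ρ k).sup (m k) then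
            faceSign K (blockPart ρ k) j * c k (insert j (blockPart ρ k)) else 0 by
        rw [Finset.sum_congr rfl fun j _ => h j, ← Finset.mul_sum, hk, mul_zero]
      intro j
      rw [mul_ite, mul_zero]
      refine if_congr (by rw [concatGens_blockIndex, mapDomain_le_concatDeg_iff, mem_blockPart])
        ?_ rfl
      have hins : ∀ x, lastIndex μ x ∉ insert (blockIndex ν k j) ρ := fun x hx =>
        (Finset.mem_insert.1 hx).elim (fun h => blockIndex_ne_lastIndex _ _ h.symm) (hρ x)
      rw [prodCoeff, if_pos hins, ← Finset.mul_prod_erase _ _ (Finset.mem_univ k),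
        blockPart_insert_self, faceSign_blockIndex,
        Finset.prod_congr rfl fun l hl => by
          rw [blockPart_insert_of_ne ρ (Finset.ne_of_mem_erase hl) j]]
      ring
  · refine Finset.sum_eq_zero fun t _ => ?_
    have : prodCoeff c (insert t ρ) = 0 :=
      if_neg fun h => hρ fun x hx => h x (Finset.mem_insert_of_mem hx)
    rw [this, mul_zero]

end Concat

/-- The hypothesis on a single block, expressed by a cycle of `L ⊗ K` that is homogeneous of the
degree of the given symbol. -/
lemma exists_homogeneous_cycle {K ι Λ : Type*} [Field K] [LinearOrder Λ] [Fintype Λ]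
    [DecidableEq (Finset Λ)] {m : Λ → (ι →₀ ℕ)} {s : ℕ} {τ : Finset Λ}
    (hτ : τ ∈ admissibleSymbols m s) (a : Finset Λ → MvPolynomial ι K)
    (ha : taylorD K m (Finsupp.single τ 1 +
        ∑ τ' ∈ (admissibleSymbols m s).erase τ, Finsupp.single τ' (a τ')) ∈
      irrelevant K ι • lyubeznik K m (s - 1)) :
    ∃ c : Finset Λ → K, c τ = 1 ∧
      (∀ ρ, c ρ ≠ 0 → ρ ∈ admissibleSymbols m s ∧ ρ.sup m = τ.sup m) ∧
      ∀ ρ, ∑ t with t ∉ ρ ∧ m t ≤ ρ.sup m, faceSign K ρ t * c (insert t ρ) = 0 := by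
  classical
  set v := Finsupp.single τ 1 +
    ∑ τ' ∈ (admissibleSymbols m s).erase τ, Finsupp.single τ' (a τ') with hv
  have hvL : v ∈ lyubeznik K m s :=
    Submodule.add_mem _ (single_mem_lyubeznik hτ 1) (Submodule.sum_mem _ fun τ' hτ' =>
      single_mem_lyubeznik (Finset.mem_of_mem_erase hτ') _)
  have hvτ : v τ = 1 := by
    rw [hv, Finsupp.add_apply, Finsupp.single_eq_same, Finsupp.finsetSum_apply,
      Finset.sum_eq_zero, add_zero]
    intro τ' hτ'
    exact Finsupp.single_eq_of_ne (Finset.ne_of_mem_erase hτ').symm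
  -- Only the vanishing of constant coefficients is kept, so the truncated `s - 1` at `s = 0` is
  -- harmless.
  have hd := mem_irrelevant_smul_top_iff.1 (Submodule.smul_mono le_rfl le_top ha)
  refine ⟨fun ρ => if ρ.sup m = τ.sup m then constantCoeff (v ρ) else 0, ?_, fun ρ hρ => ?_,
    fun ρ => ?_⟩
  · simp [hvτ]
  · beta_reduce at hρ
    split_ifs at hρ with h
    · exact ⟨mem_lyubeznik.1 hvL ρ fun h0 => hρ (by rw [h0, map_zero]), h⟩
    · exact absurd rfl hρ
  -- All symbols in the cycle equation at `ρ` have the degree of `ρ`, so restricting to one degree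
  -- keeps the equation or makes it trivial.
  · have hsup : ∀ t ∈ Finset.univ.filter (fun t => t ∉ ρ ∧ m t ≤ ρ.sup m),
        (insert t ρ).sup m = ρ.sup m := fun t ht => by
      rw [Finset.sup_insert, sup_eq_right]
      exact (Finset.mem_filter.1 ht).2.2
    by_cases h : ρ.sup m = τ.sup m
    · refine Eq.trans (Finset.sum_congr rfl fun t ht => ?_)
        ((constantCoeff_taylorD m v ρ).symm.trans (hd ρ))
      beta_reduce
      rw [if_pos ((hsup t ht).trans h)]
    · refine Finset.sum_eq_zero fun t ht => ?_
      beta_reduce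
      rw [if_neg fun h' => h ((hsup t ht).symm.trans h'), mul_zero]

end LyubeznikBetti

end

theorem proposition3p2 {K : Type*} [Field K] {r : ℕ} {N μ : Fin r → ℕ}
    -- monomial ideals `I_k` of `S^{(k)}`, with ordered minimal generators `m_1^{(k)}, …, m_{μ_k}^{(k)}`
    (I : ∀ k, Ideal (MvPolynomial (Fin (N k)) K))
    (hI : ∀ k, LyubeznikBetti.IsMonomialIdeal (I k))
    (m : ∀ k, Fin (μ k) → (Fin (N k) →₀ ℕ))
    (hm : ∀ k, LyubeznikBetti.ListsMinGens (I k) (m k))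
    -- `L`-admissible symbols `τ^{(k)}` and coefficients `a^{(k)}`
    (s : Fin r → ℕ)
    (τ : ∀ k, Finset (Fin (μ k)))
    (hτ : ∀ k, τ k ∈ LyubeznikBetti.admissibleSymbols (m k) (s k))
    (a : ∀ k, Finset (Fin (μ k)) → MvPolynomial (Fin (N k)) K)
    (ha : ∀ k, LyubeznikBetti.taylorD K (m k)
        (Finsupp.single (τ k) 1 +
          ∑ τ' ∈ (LyubeznikBetti.admissibleSymbols (m k) (s k)).erase (τ k),
            Finsupp.single τ' (a k τ')) ∈
      LyubeznikBetti.irrelevant K (Fin (N k)) • LyubeznikBetti.lyubeznik K (m k) (s k - 1))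
    -- the monomial ideal `J`, none of whose minimal generators lies in some `S^{(k)}`
    (J : Ideal (MvPolynomial (Σ k, Fin (N k)) K))
    (hJ : LyubeznikBetti.IsMonomialIdeal J)
    (hJgen : ∀ b ∈ LyubeznikBetti.minGens J, ∀ k,
      MvPolynomial.monomial b (1 : K) ∉ (LyubeznikBetti.incl K N k).range)
    -- the order of the minimal generators of `I_1 S + ⋯ + I_r S + J`
    {ν : ℕ} (c : Fin ν → ((Σ k, Fin (N k)) →₀ ℕ))
    (hc : LyubeznikBetti.ListsMinGens (LyubeznikBetti.sumIdeal I J) (LyubeznikBetti.concatGens m c))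
    -- the product symbol is maximal for this order
    (hmax : LyubeznikBetti.NoLargerLAdmissible (LyubeznikBetti.concatGens m c)
      (LyubeznikBetti.prodSymbol ν τ)) :
    LyubeznikBetti.gradedBetti
      (LyubeznikBetti.quotientGrading (LyubeznikBetti.sumIdeal I J))
      (∑ k, s k)
      (LyubeznikBetti.concatDeg fun k => (τ k).sup (m k)) ≠ 0 := by
  classical
  choose c hcτ hcsupp hccycle using fun k =>
    LyubeznikBetti.exists_homogeneous_cycle (hτ k) (a k) (ha k)
  have hadm := fun k => LyubeznikBetti.mem_admissibleSymbols.1 (hτ k)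
  refine LyubeznikBetti.gradedBetti_ne_zero_of_cycle
    (LyubeznikBetti.isMonomialIdeal_sumIdeal hI hJ) hc hmax (c := LyubeznikBetti.prodCoeff c)
    (fun ρ hρ => ?_) (LyubeznikBetti.prodCoeff_cycle m _ hccycle) ?_
  · rw [LyubeznikBetti.prodCoeff] at hρ
    split_ifs at hρ with hlast
    · have hk := fun k => hcsupp k _ (Finset.prod_ne_zero_iff.1 hρ k (Finset.mem_univ k))
      have hk' := fun k => LyubeznikBetti.mem_admissibleSymbols.1 (hk k).1
      rw [← LyubeznikBetti.prodSymbol_blockPart hlast, LyubeznikBetti.mem_admissibleSymbols,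
        LyubeznikBetti.card_prodSymbol, LyubeznikBetti.sup_prodSymbol]
      refine ⟨⟨Finset.sum_congr rfl fun k _ => (hk' k).1,
        LyubeznikBetti.lAdmissible_prodSymbol hc fun k => (hk' k).2⟩, ?_⟩
      simp only [fun k => (hk k).2]
    · exact absurd rfl hρ
  -- The coefficient at the product symbol is the product of the coefficients at the `τ k`, each
  -- equal to `1`.
  · rw [LyubeznikBetti.prodCoeff, if_pos (LyubeznikBetti.lastIndex_notMem_prodSymbol τ),
      Finset.prod_ne_zero_iff]
    intro k _
    rw [LyubeznikBetti.blockPart_prodSymbol, hcτ]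
    exact one_ne_zero
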